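/- **Proposition 4.3 (string and dilaton equations).** For partitions $\lambda,\mu$ of $d$ let $\chi^\lambda_\mu$ be the value of the irreducible character of $S_d$ associated with $\lambda$ on permutations of cycle type $\mu$, and let $$p_3(\lambda)=\sum_{i\ge 1}\Big(\big(\lambda_i-i+\tfrac12\big)^3-\big(-i+\tfrac12\big)^3\Big).$$ Let $g\ge 0$ and let $n\ge 1$ be odd. For positive integers $\beta_1,\dots,\beta_n$ put $d=\beta_1+\dots+\beta_n$, $s=g+\frac{n-1}{2}$, and let $$H^{g,(2)}_{(d),\beta}=\frac{1}{d\,\beta_1\cdots\beta_n}\sum_{\lambda\vdash d}\chi^\lambda_{(d)}\Big(\frac{p_3(\lambda)}{3!}\Big)^{s}\chi^\lambda_\beta$$ be the one-part double Hurwitz number with completed $3$-cycles. Then $d\,H^{g,(2)}_{(d),\beta}/s!$ is given, for all positive integers $\beta_1,\dots,\beta_n$, by a unique polynomial $P_{g,n}\in\mathbb{Q}[\beta_1,\dots,\beta_n]$. For integers $b_1,\dots,b_n\ge 0$ with $b_1+\dots+b_n=g+\frac{n-1}{2}$, define the lowest-degree combinatorial Hodge integral by $$\langle\langle\tau_{b_1}\cdots\tau_{b_n}\Lambda_{2g}\rangle\rangle_g=(-1)^g\,[\beta_1^{b_1}\cdots\beta_n^{b_n}]\,P_{g,n},$$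 and let it be $0$ if some $b_i$ is negative. Then the following identities hold for all $g\ge0$, all odd $n\ge1$ and all integers $b_1,\dots,b_n\ge 0$. *String equation.* If $b_1+\dots+b_n=g+\frac{n+1}{2}$, then $$\langle\langle\tau_0^2\tau_{b_1}\cdots\tau_{b_n}\Lambda_{2g}\rangle\rangle_g=(2g+n)\sum_{i=1}^n\langle\langle\tau_{b_1}\cdots\tau_{b_{i-1}}\tau_{b_i-1}\tau_{b_{i+1}}\cdots\tau_{b_n}\Lambda_{2g}\rangle\rangle_g.$$ *Dilaton equation.* If $b_1+\dots+b_n=g+\frac{n-1}{2}$, then $$\langle\langle\tau_0\tau_1\tau_{b_1}\cdots\tau_{b_n}\Lambda_{2g}\rangle\rangle_g=(2g+n)\Big(g+\frac{n+1}{2}\Big)\langle\langle\tau_{b_1}\cdots\tau_{b_n}\Lambda_{2g}\rangle\rangle_g.$$ -/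

import Mathlib

noncomputable section

namespace CompletedHurwitz

/-! ### Irreducible characters of the symmetric groups -/

/-- The parts `λ₁ ≥ λ₂ ≥ …` of a partition, listed in weakly decreasing order. -/
def rows {d : ℕ} (lam : Nat.Partition d) : List ℕ :=
  lam.parts.sort (· ≥ ·)

theorem rows_sortedGE {d : ℕ} (lam : Nat.Partition d) : (rows lam).SortedGE :=
  (Multiset.pairwise_sort lam.parts (· ≥ ·)).sortedGE

theorem sum_rows {d : ℕ} (lam : Nat.Partition d) : (rows lam).sum = d := by
  rw [← Multiset.sum_coe, rows, Multiset.sort_eq, lam.parts_sum]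

/-- The Young diagram of a partition: the cell `(i, j)` lies in row `i` and column `j`. -/
def diagram {d : ℕ} (lam : Nat.Partition d) : YoungDiagram :=
  YoungDiagram.ofRowLens (rows lam) (rows_sortedGE lam)

theorem card_cellsOfRowLens (w : List ℕ) :
    (YoungDiagram.cellsOfRowLens w).card = w.sum := by
  induction w with
  | nil => rfl
  | cons a w ih =>
    rw [YoungDiagram.cellsOfRowLens, Finset.card_union_of_disjoint]
    · simp [ih]
    · rw [Finset.disjoint_left]
      rintro ⟨i, j⟩ h h'
      simp at h h'
      omega

theorem card_cells {d : ℕ} (lam : Nat.Partition d) : (diagram lam).cells.card = d :=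
  (card_cellsOfRowLens (rows lam)).trans (sum_rows lam)

/-- A Young tableau of shape `lam`: a bijective filling of the cells by `d` labels. -/
abbrev Tableau {d : ℕ} (lam : Nat.Partition d) : Type :=
  Fin d ≃ (diagram lam).cells

/-- A fixed tableau of each shape; up to isomorphism the Specht module does not depend on it. -/
def tableau {d : ℕ} (lam : Nat.Partition d) : Tableau lam :=
  ((diagram lam).cells.equivFinOfCardEq (card_cells lam)).symm

open scoped Classical in
/-- The row symmetrizer: the sum of all permutations preserving every row of the tableau. -/
def rowSymmetrizer {d : ℕ} {lam : Nat.Partition d} (T : Tableau lam) :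
    MonoidAlgebra ℚ (Equiv.Perm (Fin d)) :=
  ∑ p : Equiv.Perm (Fin d) with ∀ x, (T (p x)).1.1 = (T x).1.1, MonoidAlgebra.single p 1

open scoped Classical in
/-- The column antisymmetrizer: the signed sum of all permutations preserving every column of
the tableau. -/
def colAntisymmetrizer {d : ℕ} {lam : Nat.Partition d} (T : Tableau lam) :
    MonoidAlgebra ℚ (Equiv.Perm (Fin d)) :=
  ∑ q : Equiv.Perm (Fin d) with ∀ x, (T (q x)).1.2 = (T x).1.2,
    MonoidAlgebra.single q ((Equiv.Perm.sign q : ℤ) : ℚ)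

/-- The Young symmetrizer of a tableau. -/
def youngSymmetrizer {d : ℕ} {lam : Nat.Partition d} (T : Tableau lam) :
    MonoidAlgebra ℚ (Equiv.Perm (Fin d)) :=
  rowSymmetrizer T * colAntisymmetrizer T

/-- The Specht module `V_λ`, i.e. the irreducible module of `S_d` associated with `lam`: the left
ideal of the group algebra generated by the Young symmetrizer. -/
def spechtModule {d : ℕ} (lam : Nat.Partition d) :
    Submodule (MonoidAlgebra ℚ (Equiv.Perm (Fin d))) (MonoidAlgebra ℚ (Equiv.Perm (Fin d))) :=
  Submodule.span _ {youngSymmetrizer (tableau lam)}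

/-- The irreducible representation of `S_d` on the Specht module, by left multiplication. -/
def spechtRep {d : ℕ} (lam : Nat.Partition d) :
    Representation ℚ (Equiv.Perm (Fin d)) (spechtModule lam) :=
  Representation.ofModule' (spechtModule lam)

theorem exists_perm_of_type {d : ℕ} (mu : Nat.Partition d) :
    ∃ σ : Equiv.Perm (Fin d), σ.partition.parts = mu.parts := by
  have hle : ∀ a ∈ mu.parts.filter (fun a => ¬ 2 ≤ a), a = 1 := by
    intro a ha
    rw [Multiset.mem_filter] at ha
    have := mu.parts_pos ha.1
    omega
  have hadd := Multiset.filter_add_not (fun a => 2 ≤ a) mu.parts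
  have hone := Multiset.eq_replicate_card.mpr hle
  have hsum : (mu.parts.filter (fun a => 2 ≤ a)).sum
      + (mu.parts.filter (fun a => ¬ 2 ≤ a)).card = d := by
    have h := congrArg Multiset.sum hadd
    rw [Multiset.sum_add, mu.parts_sum, hone] at h
    simpa using h
  obtain ⟨σ, hσ⟩ := (Equiv.Perm.exists_with_cycleType_iff (Fin d)
    (m := mu.parts.filter (fun a => 2 ≤ a))).mpr
    ⟨by rw [Fintype.card_fin]; omega, fun a ha => (Multiset.mem_filter.mp ha).2⟩
  refine ⟨σ, ?_⟩
  rw [Equiv.Perm.parts_partition, ← Equiv.Perm.sum_cycleType, hσ, Fintype.card_fin,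
    show d - (mu.parts.filter (fun a => 2 ≤ a)).sum
      = (mu.parts.filter (fun a => ¬ 2 ≤ a)).card by omega, ← hone, hadd]

/-- A permutation of cycle type `mu`, fixed points being counted as parts equal to `1`. -/
def permOfType {d : ℕ} (mu : Nat.Partition d) : Equiv.Perm (Fin d) :=
  (exists_perm_of_type mu).choose

/-- The irreducible character `χ^λ_μ`: the character of the irreducible representation associated
with `lam`, on the conjugacy class of permutations of cycle type `mu`. -/
def chi {d : ℕ} (lam mu : Nat.Partition d) : ℚ :=
  (spechtRep lam).character (permOfType mu)

/-! ### Double Hurwitz numbers with completed cycles -/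

/-- The shifted symmetric power sum
`p_k(λ) = ∑_{i ≥ 1} ((λ_i - i + 1/2)^k - (-i + 1/2)^k)`; the terms with `i > ℓ(λ)` vanish, and the
index `i` below is shifted by one. -/
def shiftedPowerSum {d : ℕ} (k : ℕ) (lam : Nat.Partition d) : ℚ :=
  ∑ i : Fin (rows lam).length,
    ((((rows lam).get i : ℚ) - ((i : ℚ) + 1) + 1 / 2) ^ k - (-((i : ℚ) + 1) + 1 / 2) ^ k)

/-- The number `s` of completed cycles, determined by `r s = 2g - 2 + ℓ(α) + ℓ(β)`. -/
def numCycles {d : ℕ} (g r : ℕ) (alpha beta : Nat.Partition d) : ℕ :=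
  (2 * g + alpha.parts.card + beta.parts.card - 2) / r

/-- The double Hurwitz number `H^{g,(r)}_{α,β}` with completed `(r+1)`-cycles (for `α`, `β` and `g`
such that `r` divides `2g - 2 + ℓ(α) + ℓ(β)`). -/
def doubleHurwitz {d : ℕ} (g r : ℕ) (alpha beta : Nat.Partition d) : ℚ :=
  1 / ((alpha.parts.prod : ℚ) * (beta.parts.prod : ℚ)) *
    ∑ lam : Nat.Partition d, chi lam alpha *
      (shiftedPowerSum (r + 1) lam / ((r + 1).factorial : ℚ)) ^ numCycles g r alpha beta *
        chi lam beta

/-! ### Combinatorial Hodge integrals -/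

/-- The partition of `β₁ + … + β_n` with parts `β₁, …, β_n`. -/
def ofTuple {n : ℕ} (beta : Fin n → ℕ) : Nat.Partition (∑ i, beta i) :=
  Nat.Partition.ofSums _ (Finset.univ.val.map beta) rfl

/-- `P` is the polynomial `d H^{g,(2)}_{(d),β} / s!` in the parts `β₁, …, β_n`: it takes this value
at all `n`-tuples of positive integers, where `d = β₁ + … + β_n`. -/
def IsHurwitzPolynomial (g n : ℕ) (P : MvPolynomial (Fin n) ℚ) : Prop :=
  ∀ beta : Fin n → ℕ, (∀ i, 0 < beta i) →
    MvPolynomial.eval (fun i => (beta i : ℚ)) P =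
      ((∑ i, beta i : ℕ) : ℚ) *
        doubleHurwitz g 2 (Nat.Partition.indiscrete (∑ i, beta i)) (ofTuple beta) /
          ((numCycles g 2 (Nat.Partition.indiscrete (∑ i, beta i)) (ofTuple beta)).factorial : ℚ)

open scoped Classical in
/-- The polynomial `d H^{g,(2)}_{(d),β} / s!` in `β₁, …, β_n` (zero if there is none). -/
def hurwitzPolynomial (g n : ℕ) : MvPolynomial (Fin n) ℚ :=
  if h : ∃ P, IsHurwitzPolynomial g n P then h.choose else 0

open scoped Classical in
/-- The combinatorial Hodge integral `⟨⟨τ_{b₁} … τ_{b_n} Λ_{2k}⟩⟩_g`, that is `(-1)^k` times the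
coefficient of `β₁^{b₁} … β_n^{b_n}` in `d H^{g,(2)}_{(d),β} / s!`. It vanishes by convention if some
`b_i` is negative, and unless `b₁ + … + b_n + 2k = 3g + (n-1)/2`. -/
def hodgeIntegral {n : ℕ} (g k : ℕ) (b : Fin n → ℤ) : ℚ :=
  if (∀ i, 0 ≤ b i) ∧ (∑ i, (b i : ℚ)) + 2 * k = 3 * g + ((n : ℚ) - 1) / 2 then
    (-1) ^ k * (hurwitzPolynomial g n).coeff (Finsupp.equivFunOnFinite.symm fun i => (b i).toNat)
  else 0

end CompletedHurwitz

end

open CompletedHurwitz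

/-! The one-part numbers can be computed in closed form. On a long cycle only hooks $(d-k,1^k)$ have
a nonzero character, namely $(-1)^k$ (`chi_nonhook`, `chi_hook_indiscrete`), and their values at
$\mu$ are the coefficients of $Q=\prod_i(1-(-X)^{\mu_i})/(1+X)$ (`chi_hook`). For a hook,
$p_3/3!=\frac d2\big(c^2+\frac{d^2}{12}\big)$ with $c=k-\frac{d-1}2$, so the Hurwitz number is a
combination of even moments of $c$ with weights $(-1)^kQ_k$. Substituting $X=-e^u$ in $Q$ gives
their exponential generating series $\prod_i\beta_i\cdot u^{n-1}\prod_i S(\beta_iu)/S(u)$, where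
$S(u)=2\sinh(u/2)/u$.

Hence $P_{g,n}=(\sum\beta_i)^s\cdot F$ with an explicit polynomial $F$. In degree $s$ only the
constant term of $F$ matters, and
$\langle\langle\tau_{b_1}\cdots\tau_{b_n}\Lambda_{2g}\rangle\rangle_g=(-1)^g\,[u^{2g}]S(u)^{-1}\,\frac{(2s)!}{2^s}\prod_i\frac1{b_i!}$
(`hodgeIntegral_eq`). Passing from $n$ to $n+2$ raises $s$ by one and multiplies $(2s)!/2^s$ by
$(2s+1)(s+1)$, where $2s+1=2g+n$; both equations follow.

The character values are derived from the Specht modules themselves. Hook symmetrizers are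
quasi-idempotent (`hook_sq`), so the characters are class traces of them, and a Pieri-type recursion
reduces these traces to coefficients of $\det(1+XP)$ (`classTrace_hook`). For a non-hook shape, a
combination of hook symmetrizers supported on the long cycles annihilates the Specht module. -/

noncomputable section

namespace CompletedHurwitz

open Equiv Finset

/-! ### Weighted sums over the permutations of a subset -/

section WeightedSum

open MonoidAlgebra

variable {α : Type*} [Fintype α] [DecidableEq α]

/-- The rational value `±1` of a sign character at a permutation. -/
def signValue (ε : Perm α →* ℤˣ) (p : Perm α) : ℚ := ((ε p : ℤ) : ℚ)

omit [Fintype α] [DecidableEq α] in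
theorem signValue_mul (ε : Perm α →* ℤˣ) (p q : Perm α) :
    signValue ε (p * q) = signValue ε p * signValue ε q := by
  simp [signValue]

omit [Fintype α] [DecidableEq α] in
theorem signValue_one (ε : Perm α →* ℤˣ) : signValue ε 1 = 1 := by
  simp [signValue]

omit [Fintype α] [DecidableEq α] in
theorem signValue_mul_self (ε : Perm α →* ℤˣ) (p : Perm α) :
    signValue ε p * signValue ε p = 1 := by
  rw [signValue, ← Int.cast_mul, ← Units.val_mul, Int.units_mul_self]
  simp

omit [Fintype α] [DecidableEq α] in
theorem signValue_inv (ε : Perm α →* ℤˣ) (p : Perm α) :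
    signValue ε p⁻¹ = signValue ε p := by
  simp [signValue]

omit [Fintype α] [DecidableEq α] in
theorem signValue_conj (ε : Perm α →* ℤˣ) (u p : Perm α) :
    signValue ε (u * p * u⁻¹) = signValue ε p := by
  rw [signValue_mul, signValue_mul, signValue_inv, mul_comm, ← mul_assoc, signValue_mul_self,
    one_mul]

omit [Fintype α] [DecidableEq α] in
@[simp] theorem signValue_trivial (p : Perm α) : signValue (1 : Perm α →* ℤˣ) p = 1 := by
  simp [signValue]

theorem signValue_sign_swap {x y : α} (h : x ≠ y) : signValue Perm.sign (swap x y) = -1 := by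
  simp [signValue, Perm.sign_swap h]

/-- The permutations fixing every point outside `X`. -/
def permsOn (X : Finset α) : Finset (Perm α) := univ.filter fun p => ∀ x, x ∉ X → p x = x

theorem mem_permsOn {X : Finset α} {p : Perm α} : p ∈ permsOn X ↔ ∀ x, x ∉ X → p x = x := by
  simp [permsOn]

theorem mul_mem_permsOn {X : Finset α} {p q : Perm α} (hp : p ∈ permsOn X) (hq : q ∈ permsOn X) :
    p * q ∈ permsOn X := by
  rw [mem_permsOn] at *
  intro x hx
  rw [Perm.mul_apply, hq x hx, hp x hx]

theorem inv_mem_permsOn {X : Finset α} {p : Perm α} (hp : p ∈ permsOn X) : p⁻¹ ∈ permsOn X := by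
  rw [mem_permsOn] at *
  intro x hx
  rw [Perm.inv_eq_iff_eq, hp x hx]

theorem permsOn_mono {X Y : Finset α} (h : X ⊆ Y) : permsOn X ⊆ permsOn Y := fun _ hp =>
  mem_permsOn.2 fun x hx => mem_permsOn.1 hp x fun hx' => hx (h hx')

theorem swap_mem_permsOn {X : Finset α} {x y : α} (hx : x ∈ X) (hy : y ∈ X) :
    swap x y ∈ permsOn X :=
  mem_permsOn.2 fun _ hz => swap_apply_of_ne_of_ne (fun h => hz (h ▸ hx)) (fun h => hz (h ▸ hy))

theorem apply_mem_of_mem_permsOn {X : Finset α} {p : Perm α} (hp : p ∈ permsOn X) {x : α}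
    (hx : x ∈ X) : p x ∈ X := by
  by_contra h
  have h1 := mem_permsOn.1 hp _ h
  exact h (by rwa [p.injective h1])

theorem card_permsOn (X : Finset α) : (permsOn X).card = X.card.factorial := by
  rw [permsOn, ← Fintype.card_subtype]
  have e := Perm.subtypeEquivSubtypePerm (fun x => x ∈ X)
  rw [← Fintype.card_congr e, Fintype.card_perm, Fintype.card_coe]

/-- The sum of the permutations of `X`, weighted by a sign character. -/
def weightedSum (ε : Perm α →* ℤˣ) (X : Finset α) : MonoidAlgebra ℚ (Perm α) :=
  ∑ p ∈ permsOn X, single p (signValue ε p)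

theorem weightedSum_mul_single (ε : Perm α →* ℤˣ) {X : Finset α} {p : Perm α}
    (hp : p ∈ permsOn X) :
    weightedSum ε X * single p 1 = signValue ε p • weightedSum ε X := by
  rw [weightedSum, sum_mul, smul_sum]
  refine sum_nbij' (· * p) (· * p⁻¹) (fun q hq => mul_mem_permsOn hq hp)
    (fun q hq => mul_mem_permsOn hq (inv_mem_permsOn hp)) (by simp) (by simp) fun q hq => ?_
  rw [single_mul_single, smul_single, signValue_mul, smul_eq_mul, mul_left_comm,
    signValue_mul_self]

theorem single_mul_weightedSum (ε : Perm α →* ℤˣ) {X : Finset α} {p : Perm α}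
    (hp : p ∈ permsOn X) :
    single p 1 * weightedSum ε X = signValue ε p • weightedSum ε X := by
  rw [weightedSum, mul_sum, smul_sum]
  refine sum_nbij' (p * ·) (p⁻¹ * ·) (fun q hq => mul_mem_permsOn hp hq)
    (fun q hq => mul_mem_permsOn (inv_mem_permsOn hp) hq) (by simp) (by simp) fun q hq => ?_
  rw [single_mul_single, smul_single, signValue_mul, smul_eq_mul, ← mul_assoc,
    signValue_mul_self]

theorem weightedSum_mul_weightedSum (ε : Perm α →* ℤˣ) {X Y : Finset α} (h : Y ⊆ X) :
    weightedSum ε X * weightedSum ε Y = (Y.card.factorial : ℚ) • weightedSum ε X := by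
  nth_rewrite 2 [weightedSum]
  rw [mul_sum, ← card_permsOn, Nat.cast_smul_eq_nsmul, ← sum_const]
  refine sum_congr rfl fun p hp => ?_
  have h1 : (single p (signValue ε p) : MonoidAlgebra ℚ (Perm α)) = signValue ε p • single p 1 := by
    rw [smul_single, smul_eq_mul, mul_one]
  rw [h1, mul_smul_comm, weightedSum_mul_single ε (permsOn_mono h hp), smul_smul,
    signValue_mul_self, one_smul]

theorem weightedSum_mul_weightedSum' (ε : Perm α →* ℤˣ) {X Y : Finset α} (h : Y ⊆ X) :
    weightedSum ε Y * weightedSum ε X = (Y.card.factorial : ℚ) • weightedSum ε X := by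
  nth_rewrite 1 [weightedSum]
  rw [sum_mul, ← card_permsOn, Nat.cast_smul_eq_nsmul, ← sum_const]
  refine sum_congr rfl fun p hp => ?_
  have h1 : (single p (signValue ε p) : MonoidAlgebra ℚ (Perm α)) = signValue ε p • single p 1 := by
    rw [smul_single, smul_eq_mul, mul_one]
  rw [h1, smul_mul_assoc, single_mul_weightedSum ε (permsOn_mono h hp), smul_smul,
    signValue_mul_self, one_smul]

omit [Fintype α] [DecidableEq α] in
theorem ne_inv_apply_of_fixed {p : Perm α} {y z : α} (hz : z ≠ y) (h : p z = z) :
    z ≠ p⁻¹ y := by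
  rintro rfl
  exact hz (by rw [← h]; simp)

/-- Right coset decomposition. -/
theorem weightedSum_insert (ε : Perm α →* ℤˣ) {X : Finset α} {y : α} (hy : y ∉ X) :
    weightedSum ε (insert y X) =
      weightedSum ε X * ∑ x ∈ insert y X, single (swap x y) (signValue ε (swap x y)) := by
  rw [weightedSum, weightedSum, sum_mul_sum, ← sum_product']
  symm
  -- The coset of `p` is labelled by the point that `p` sends to `y`.
  refine sum_bij' (fun a _ => a.1 * swap a.2 y) (fun p _ => (p * swap (p⁻¹ y) y, p⁻¹ y))
    ?_ ?_ ?_ ?_ ?_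
  · rintro ⟨p, x⟩ h
    rw [mem_product] at h
    exact mul_mem_permsOn (permsOn_mono (subset_insert _ _) h.1)
      (swap_mem_permsOn h.2 (mem_insert_self _ _))
  · intro p hp
    rw [mem_product]
    refine ⟨mem_permsOn.2 fun z hz => ?_,
      apply_mem_of_mem_permsOn (inv_mem_permsOn hp) (mem_insert_self _ _)⟩
    by_cases hzy : z = y
    · simp [hzy]
    · have hpz := mem_permsOn.1 hp z (by simp [hzy, hz])
      rw [Perm.mul_apply, swap_apply_of_ne_of_ne (ne_inv_apply_of_fixed hzy hpz) hzy, hpz]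
  · rintro ⟨p, x⟩ h
    rw [mem_product] at h
    have hpy : p⁻¹ y = y := mem_permsOn.1 (inv_mem_permsOn h.1) y hy
    have : (p * swap x y)⁻¹ y = x := by
      rw [mul_inv_rev, Perm.mul_apply, hpy, swap_inv, swap_apply_right]
    simp only [this, mul_assoc, swap_mul_self, mul_one]
  · intro p hp
    simp [mul_assoc]
  · rintro ⟨p, x⟩ h
    simp [single_mul_single, signValue_mul]

/-- Left coset decomposition. -/
theorem weightedSum_insert' (ε : Perm α →* ℤˣ) {X : Finset α} {y : α} (hy : y ∉ X) :
    weightedSum ε (insert y X) =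
      (∑ x ∈ insert y X, single (swap x y) (signValue ε (swap x y))) * weightedSum ε X := by
  rw [weightedSum, weightedSum, sum_mul_sum, ← sum_product']
  symm
  refine sum_bij' (fun a _ => swap a.1 y * a.2) (fun p _ => (p y, swap (p y) y * p))
    ?_ ?_ ?_ ?_ ?_
  · rintro ⟨x, p⟩ h
    rw [mem_product] at h
    exact mul_mem_permsOn (swap_mem_permsOn h.1 (mem_insert_self _ _))
      (permsOn_mono (subset_insert _ _) h.2)
  · intro p hp
    rw [mem_product]
    refine ⟨apply_mem_of_mem_permsOn hp (mem_insert_self _ _), mem_permsOn.2 fun z hz => ?_⟩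
    by_cases hzy : z = y
    · simp [hzy]
    · have hpz := mem_permsOn.1 hp z (by simp [hzy, hz])
      rw [Perm.mul_apply, hpz, swap_apply_of_ne_of_ne _ hzy]
      intro h
      exact hzy (p.injective (hpz.trans h))
  · rintro ⟨x, p⟩ h
    rw [mem_product] at h
    have hpy : p y = y := mem_permsOn.1 h.2 y hy
    simp [hpy, ← mul_assoc]
  · intro p hp
    simp [← mul_assoc]
  · rintro ⟨x, p⟩ h
    simp [single_mul_single, signValue_mul]

theorem commute_of_mem_permsOn {X : Finset α} {p q : Perm α} (hp : p ∈ permsOn X)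
    (hq : ∀ x ∈ X, q x = x) : Commute p q := by
  refine (Perm.Disjoint.commute fun x => ?_)
  by_cases hx : x ∈ X
  · exact Or.inr (hq x hx)
  · exact Or.inl (mem_permsOn.1 hp x hx)

theorem commute_weightedSum_single (ε : Perm α →* ℤˣ) {X : Finset α} {q : Perm α}
    (hq : ∀ x ∈ X, q x = x) (c : ℚ) : Commute (weightedSum ε X) (single q c) :=
  Commute.sum_left _ _ _ fun _ hp =>
    single_commute_single (commute_of_mem_permsOn hp hq) (Commute.all _ _)

theorem commute_weightedSum (ε δ : Perm α →* ℤˣ) {X Y : Finset α} (h : Disjoint X Y) :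
    Commute (weightedSum ε X) (weightedSum δ Y) :=
  Commute.sum_right _ _ _ fun _ hq => commute_weightedSum_single ε
    (fun x hx => mem_permsOn.1 hq x (disjoint_left.1 h hx)) _

theorem conj_mem_permsOn {X : Finset α} {u p : Perm α} (hp : p ∈ permsOn X) :
    u * p * u⁻¹ ∈ permsOn (X.map u.toEmbedding) := by
  rw [mem_permsOn] at *
  intro x hx
  have : u⁻¹ x ∉ X := fun h => hx (mem_map.2 ⟨u⁻¹ x, h, by simp⟩)
  rw [Perm.mul_apply, Perm.mul_apply, hp _ this]
  simp

theorem conj_weightedSum (ε : Perm α →* ℤˣ) (X : Finset α) (u : Perm α) :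
    single u 1 * weightedSum ε X * single u⁻¹ 1 = weightedSum ε (X.map u.toEmbedding) := by
  rw [weightedSum, weightedSum, mul_sum, sum_mul]
  refine sum_nbij' (fun p => u * p * u⁻¹) (fun p => u⁻¹ * p * u) (fun p hp => conj_mem_permsOn hp)
    (fun p hp => ?_) (fun p _ => by group) (fun p _ => by group) fun p _ => ?_
  · have := conj_mem_permsOn (u := u⁻¹) hp
    rw [inv_inv] at this
    convert this
    ext x
    rw [mem_map_equiv, mem_map_equiv]
    change _ ↔ u⁻¹ (u x) ∈ X
    simp
  · simp [single_mul_single, signValue_conj]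

omit [Fintype α] [DecidableEq α] in
/-- Two elements on which a transposition acts with different signs annihilate each other. -/
theorem mul_eq_zero_of_swap {z w : MonoidAlgebra ℚ (Perm α)} {u t : Perm α} {a b : ℚ}
    (hab : a ≠ b) (hz : z * single (u * t * u⁻¹) 1 = a • z) (hw : single t 1 * w = b • w) :
    z * single u 1 * w = 0 := by
  have h : a • (z * single u 1 * w) = b • (z * single u 1 * w) := by
    rw [← smul_mul_assoc, ← smul_mul_assoc, ← hz, ← mul_smul_comm, ← hw, mul_assoc z,
      single_mul_single, inv_mul_cancel_right, ← mul_assoc (z * single u 1),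
      mul_assoc z (single u 1), single_mul_single]
  have h2 : (a - b) • (z * single u 1 * w) = 0 := by rw [sub_smul, h, sub_self]
  calc z * single u 1 * w = ((a - b)⁻¹ * (a - b)) • (z * single u 1 * w) := by
        rw [inv_mul_cancel₀ (sub_ne_zero.2 hab), one_smul]
    _ = 0 := by rw [mul_smul, h2, smul_zero]

/-- Conjugation by `u` turns `swap x y` into `swap (u x) (u y)`, which the left factor absorbs with
sign $+1$, while the right factor absorbs `swap x y` with sign $-1$. -/
theorem symm_mul_single_mul_anti {X Y : Finset α} {u : Perm α} {x y : α} (hxy : x ≠ y)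
    (hx : x ∈ Y) (hy : y ∈ Y) (hux : u x ∈ X) (huy : u y ∈ X) :
    weightedSum 1 X * single u 1 * weightedSum Perm.sign Y = 0 := by
  refine mul_eq_zero_of_swap (t := swap x y) (a := 1) (b := -1) (by norm_num) ?_ ?_
  · rw [← swap_apply_apply, weightedSum_mul_single _ (swap_mem_permsOn hux huy), signValue_trivial]
  · rw [single_mul_weightedSum _ (swap_mem_permsOn hx hy), signValue_sign_swap hxy]

/-! ### The Young symmetrizer of a hook -/

/-- Write $a=a'(1+\sum_r (r\,o))$. Since $a'$ commutes with $b$, $abab=|R|!\,\big(ab\,b+\sum_r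
ab\,(r\,o)\,b\big)$. The first term is $(|C|+1)!\,ab$ and each of the $|R|$ others is $|C|!\,ab$. -/
theorem hook_sq {R C : Finset α} {o : α} (hR : o ∉ R) (hC : o ∉ C) (hRC : Disjoint R C) :
    (weightedSum 1 (insert o R) * weightedSum Perm.sign (insert o C)) *
      (weightedSum 1 (insert o R) * weightedSum Perm.sign (insert o C)) =
    ((R.card.factorial : ℚ) * C.card.factorial * (R.card + C.card + 1)) •
      (weightedSum 1 (insert o R) * weightedSum Perm.sign (insert o C)) := by
  set a := weightedSum 1 (insert o R) with ha
  set b := weightedSum Perm.sign (insert o C) with hb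
  set a' := weightedSum 1 R with ha'
  set b' := weightedSum Perm.sign C with hb'
  have ea : a = a' * (1 + ∑ r ∈ R, single (swap r o) 1) := by
    rw [ha, weightedSum_insert _ hR, sum_insert hR]
    simp [← Perm.one_def, MonoidAlgebra.one_def, ha']
  have eb : b = (1 - ∑ j ∈ C, single (swap j o) 1) * b' := by
    rw [hb, weightedSum_insert' _ hC, sum_insert hC, sub_eq_add_neg, ← sum_neg_distrib]
    congr 2
    · simp [← Perm.one_def, MonoidAlgebra.one_def, signValue_one]
    · refine sum_congr rfl fun j hj => ?_
      have hjo : j ≠ o := fun h => hC (h ▸ hj)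
      rw [signValue_sign_swap hjo, single_neg]
  have hba' : b * a' = a' * b := by
    refine (commute_weightedSum _ _ ?_).eq
    rw [disjoint_insert_left]
    exact ⟨hR, hRC.symm⟩
  have haa' : a * a' = (R.card.factorial : ℚ) • a := weightedSum_mul_weightedSum _ (subset_insert _ _)
  have hbb : b * b = ((C.card + 1).factorial : ℚ) • b := by
    rw [hb, weightedSum_mul_weightedSum _ (Subset.refl _), card_insert_of_notMem hC]
  have hb'b : b' * b = (C.card.factorial : ℚ) • b := weightedSum_mul_weightedSum' _ (subset_insert _ _)
  have key : ∀ r ∈ R, a * b * single (swap r o) 1 * b = (C.card.factorial : ℚ) • (a * b) := by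
    intro r hr
    have hro : r ≠ o := fun h => hR (h ▸ hr)
    have hcomm : b' * single (swap r o) 1 = single (swap r o) 1 * b' := by
      refine (commute_weightedSum_single _ (fun x hx => swap_apply_of_ne_of_ne ?_ ?_) _).eq
      · rintro rfl; exact disjoint_left.1 hRC hr hx
      · rintro rfl; exact hC hx
    -- The permutation $(j\,o)(r\,o)$ sends the column entries $j,o$ to the row entries $o,r$, so
    -- the product vanishes. Only the identity term of `eb` survives in `key`.
    have h0 : ∀ j ∈ C, a * single (swap j o) 1 * single (swap r o) 1 * b = 0 := by
      intro j hj
      have hjo : j ≠ o := fun h => hC (h ▸ hj)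
      have hjr : j ≠ r := by rintro rfl; exact disjoint_left.1 hRC hr hj
      rw [mul_assoc a, single_mul_single, mul_one]
      refine symm_mul_single_mul_anti hjo (mem_insert_of_mem hj) (mem_insert_self _ _) ?_ ?_
      · rw [Perm.mul_apply, swap_apply_of_ne_of_ne hjr hjo, swap_apply_left]
        exact mem_insert_self _ _
      · rw [Perm.mul_apply, swap_apply_right, swap_apply_of_ne_of_ne hjr.symm hro]
        exact mem_insert_of_mem hr
    have har : a * single (swap r o) 1 = a := by
      rw [ha, weightedSum_mul_single _ (swap_mem_permsOn (mem_insert_of_mem hr)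
        (mem_insert_self _ _)), signValue_trivial, one_smul]
    calc a * b * single (swap r o) 1 * b
        = a * (1 - ∑ j ∈ C, single (swap j o) 1) * (b' * single (swap r o) 1) * b := by
          nth_rewrite 1 [eb]; simp only [mul_assoc]
      _ = (a * single (swap r o) 1 - ∑ j ∈ C, a * single (swap j o) 1 * single (swap r o) 1) *
            (b' * b) := by
          rw [hcomm, mul_sub, mul_one, mul_sum, sub_mul, sub_mul, sub_mul, sum_mul, sum_mul,
            sum_mul]
          simp only [mul_assoc]
      _ = (C.card.factorial : ℚ) • (a * b) := by
          rw [hb'b, mul_smul_comm, sub_mul, sum_mul, sum_eq_zero h0, sub_zero, har]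
  calc a * b * (a * b) = a * (b * a') * (1 + ∑ r ∈ R, single (swap r o) 1) * b := by
        nth_rewrite 2 [ea]; simp only [mul_assoc]
    _ = a * a' * (b * (1 + ∑ r ∈ R, single (swap r o) 1) * b) := by
        rw [hba']; simp only [mul_assoc]
    _ = (R.card.factorial : ℚ) • (a * b * b + ∑ r ∈ R, a * b * single (swap r o) 1 * b) := by
        rw [haa', smul_mul_assoc, mul_add, mul_one, add_mul, mul_add, mul_sum, sum_mul, mul_sum]
        simp only [mul_assoc]
    _ = _ := by
        rw [sum_congr rfl key, sum_const, mul_assoc, hbb, mul_smul_comm,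
          ← Nat.cast_smul_eq_nsmul ℚ, smul_smul, ← add_smul, smul_smul, Nat.factorial_succ]
        congr 1
        push_cast
        ring

end WeightedSum

/-! ### Class traces on the group algebra -/

section ClassTrace

open MonoidAlgebra

variable {α : Type*} [Fintype α] [DecidableEq α]

/-- The sum of the coefficients over the conjugates of `u`, counted with multiplicity. -/
def classTrace (u : Perm α) : MonoidAlgebra ℚ (Perm α) →ₗ[ℚ] ℚ where
  toFun x := ∑ h : Perm α, x.coeff (h⁻¹ * u * h)
  map_add' x y := by simp [sum_add_distrib]
  map_smul' c x := by simp [mul_sum]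

theorem classTrace_apply (u : Perm α) (x : MonoidAlgebra ℚ (Perm α)) :
    classTrace u x = ∑ h : Perm α, x.coeff (h⁻¹ * u * h) := rfl

theorem classTrace_single_mul (u p : Perm α) (x : MonoidAlgebra ℚ (Perm α)) :
    classTrace u (single p 1 * x) = classTrace u (x * single p 1) := by
  rw [classTrace_apply, classTrace_apply]
  refine Fintype.sum_equiv (Equiv.mulRight p) _ _ fun h => ?_
  rw [coeff_single_mul_apply, coeff_mul_single_apply]
  simp [mul_assoc]

theorem classTrace_mul_comm (u : Perm α) (x y : MonoidAlgebra ℚ (Perm α)) :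
    classTrace u (x * y) = classTrace u (y * x) := by
  induction x using MonoidAlgebra.induction_linear with
  | zero => simp
  | add a b ha hb => rw [add_mul, mul_add, map_add, map_add, ha, hb]
  | single p c =>
    have h1 : (single p c : MonoidAlgebra ℚ (Perm α)) = c • single p 1 := by
      rw [smul_single, smul_eq_mul, mul_one]
    rw [h1, smul_mul_assoc, mul_smul_comm, map_smul, map_smul, classTrace_single_mul]

theorem classTrace_conj (u p : Perm α) (x : MonoidAlgebra ℚ (Perm α)) :
    classTrace u (single p 1 * x * single p⁻¹ 1) = classTrace u x := by
  rw [classTrace_mul_comm, ← mul_assoc, single_mul_single, inv_mul_cancel, mul_one,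
    ← MonoidAlgebra.one_def, one_mul]

omit [Fintype α] [DecidableEq α] in
theorem conj_mul (p : Perm α) (x y : MonoidAlgebra ℚ (Perm α)) :
    single p 1 * (x * y) * single p⁻¹ 1 =
      (single p 1 * x * single p⁻¹ 1) * (single p 1 * y * single p⁻¹ 1) := by
  have : (single p⁻¹ 1 * single p 1 : MonoidAlgebra ℚ (Perm α)) = 1 := by
    rw [single_mul_single, inv_mul_cancel, mul_one, MonoidAlgebra.one_def]
  calc _ = single p 1 * x * 1 * y * single p⁻¹ 1 := by simp only [mul_assoc, one_mul]
    _ = _ := by rw [← this]; simp only [mul_assoc]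

theorem classTrace_map (u p : Perm α) (ε δ : Perm α →* ℤˣ) (X Y : Finset α) :
    classTrace u (weightedSum ε (X.map p.toEmbedding) * weightedSum δ (Y.map p.toEmbedding)) =
      classTrace u (weightedSum ε X * weightedSum δ Y) := by
  rw [← conj_weightedSum, ← conj_weightedSum, ← conj_mul, classTrace_conj]

/-- Trace form of the Pieri rule: the product of a row and a column is a sum of two hooks. Expanding
over cosets, both sums produce the traces of $ab\,(x\,y)$, with opposite signs, and these cancel
because the trace is cyclic and $a$, $b$ commute. -/
theorem classTrace_hook_relation (u : Perm α) {X Y : Finset α} (h : Disjoint X Y) :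
    ∑ x ∈ X, classTrace u (weightedSum 1 X * weightedSum Perm.sign (insert x Y)) +
      ∑ y ∈ Y, classTrace u (weightedSum 1 (insert y X) * weightedSum Perm.sign Y) =
    (X.card + Y.card) * classTrace u (weightedSum 1 X * weightedSum Perm.sign Y) := by
  set a := weightedSum 1 X with ha
  set b := weightedSum Perm.sign Y with hb
  have h1 : ∀ x ∈ X, classTrace u (a * weightedSum Perm.sign (insert x Y)) =
      classTrace u (a * b) - ∑ y ∈ Y, classTrace u (a * b * single (swap x y) 1) := by
    intro x hx
    have hxY : x ∉ Y := disjoint_left.1 h hx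
    have : weightedSum Perm.sign (insert x Y) = b - ∑ y ∈ Y, b * single (swap x y) 1 := by
      rw [weightedSum_insert _ hxY, sum_insert hxY, mul_add, sub_eq_add_neg, ← sum_neg_distrib,
        mul_sum]
      congr 1
      · simp [← Perm.one_def, ← MonoidAlgebra.one_def, signValue_one, hb]
      · refine sum_congr rfl fun y hy => ?_
        have hxy : y ≠ x := fun h => hxY (h ▸ hy)
        rw [signValue_sign_swap hxy, single_neg, mul_neg, swap_comm]
    rw [this, mul_sub, mul_sum, map_sub, map_sum]
    simp only [mul_assoc]
  have h2 : ∀ y ∈ Y, classTrace u (weightedSum 1 (insert y X) * b) =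
      classTrace u (a * b) + ∑ x ∈ X, classTrace u (a * b * single (swap x y) 1) := by
    intro y hy
    have hyX : y ∉ X := disjoint_right.1 h hy
    have : weightedSum 1 (insert y X) = a + ∑ x ∈ X, a * single (swap x y) 1 := by
      rw [weightedSum_insert _ hyX, sum_insert hyX, mul_add, mul_sum]
      simp [← Perm.one_def, ← MonoidAlgebra.one_def, ha]
    rw [this, add_mul, sum_mul, map_add, map_sum]
    congr 1
    refine sum_congr rfl fun x _ => ?_
    rw [classTrace_mul_comm, ← mul_assoc, (commute_weightedSum _ _ h.symm).eq]
  rw [sum_congr rfl h1, sum_congr rfl h2, sum_sub_distrib, sum_add_distrib, sum_comm (s := X),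
    sum_const, sum_const, nsmul_eq_mul, nsmul_eq_mul]
  ring

/-! ### The characteristic polynomial of a permutation -/

/-- The matrix `1 + X P` where `P` is the matrix of the permutation `u`. -/
def oneAddMatrix (u : Perm α) : Matrix α α (Polynomial ℚ) :=
  Matrix.of fun i j => (if i = j then 1 else 0) + (if i = u j then Polynomial.X else 0)

/-- The polynomial `det (1 + X P)` where `P` is the matrix of the permutation `u`. -/
def permPoly (u : Perm α) : Polynomial ℚ := (oneAddMatrix u).det

theorem permPoly_eq_sum (u : Perm α) :
    permPoly u = ∑ q : Perm α, ((Perm.sign q : ℤ) : Polynomial ℚ) *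
      ∏ i, ((if q i = i then 1 else 0) + (if q i = u i then Polynomial.X else 0)) := by
  rw [permPoly, Matrix.det_apply']
  rfl

/-- Disjoint permutations satisfy $\sigma+\tau=1+\sigma\tau$ as matrices, so
$(1+X\sigma)(1+X\tau)=(1+X)(1+X\sigma\tau)$. -/
theorem oneAddMatrix_mul {σ τ : Perm α} (h : σ.Disjoint τ) :
    oneAddMatrix σ * oneAddMatrix τ =
      ((1 : Polynomial ℚ) + Polynomial.X) • oneAddMatrix (σ * τ) := by
  ext1 i j
  rw [Matrix.mul_apply]
  simp only [oneAddMatrix, Matrix.of_apply, Matrix.smul_apply, mul_add, smul_eq_mul,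
    sum_add_distrib, add_mul, ite_mul, mul_ite, zero_mul, mul_zero, one_mul, mul_one]
  simp only [sum_ite_eq', mem_univ, if_true]
  rcases h j with hj | hj
  · have : σ (τ j) = τ j := by
      rw [← Perm.mul_apply, h.commute.eq, Perm.mul_apply, hj]
    have e : (σ * τ) j = τ j := this
    rw [hj, this, e]
    split_ifs <;> ring
  · have e : (σ * τ) j = σ j := by rw [Perm.mul_apply, hj]
    rw [hj, e]
    split_ifs <;> ring

theorem permPoly_mul {σ τ : Perm α} (h : σ.Disjoint τ) :
    permPoly σ * permPoly τ =
      ((1 : Polynomial ℚ) + Polynomial.X) ^ Fintype.card α * permPoly (σ * τ) := by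
  rw [permPoly, permPoly, permPoly, ← Matrix.det_mul, oneAddMatrix_mul h, Matrix.det_smul]

/-- Once `q` follows `σ` at one moved point, the next point of the cycle is already a value of `q`,
so injectivity forces `q` to follow `σ` there too. Thus only two terms survive in the Leibniz
expansion for a cycle. -/
theorem eq_one_or_eq_of_isCycle {σ q : Perm α} (hσ : σ.IsCycle)
    (h : ∀ i, q i = i ∨ q i = σ i) : q = 1 ∨ q = σ := by
  by_cases hq : ∀ i, σ i ≠ i → q i = i
  · left
    ext i
    by_cases hi : σ i = i
    · rcases h i with h' | h'
      · simpa using h'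
      · simpa [hi] using h'
    · simpa using hq i hi
  · right
    push Not at hq
    obtain ⟨i, hi, hqi⟩ := hq
    have hmove : ∀ m : ℕ, q ((σ ^ m) i) = σ ((σ ^ m) i) := by
      intro m
      induction m with
      | zero => simpa using (h i).resolve_left hqi
      | succ m ih =>
        rw [pow_succ', Perm.mul_apply]
        refine (h _).resolve_left fun h' => ?_
        have h2 := q.injective (h'.trans ih.symm)
        have h3 : (σ ^ m) (σ i) = (σ ^ m) i := by
          rw [← Perm.mul_apply, ← pow_succ, pow_succ', Perm.mul_apply, h2]
        exact hi ((σ ^ m).injective h3)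
    ext j
    by_cases hj : σ j = j
    · rcases h j with h' | h'
      · rw [h', hj]
      · rw [h']
    · obtain ⟨m, rfl⟩ := hσ.exists_pow_eq hi hj
      rw [hmove m]

theorem permPoly_one :
    permPoly (1 : Perm α) = ((1 : Polynomial ℚ) + Polynomial.X) ^ Fintype.card α := by
  have : oneAddMatrix (1 : Perm α) = ((1 : Polynomial ℚ) + Polynomial.X) • 1 := by
    ext1 i j
    simp only [oneAddMatrix, Matrix.of_apply, Matrix.smul_apply, Matrix.one_apply]
    rw [Perm.one_apply]
    split_ifs <;> simp
  rw [permPoly, this, Matrix.det_smul, Matrix.det_one, mul_one]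

theorem permPoly_isCycle {σ : Perm α} (hσ : σ.IsCycle) :
    permPoly σ = ((1 : Polynomial ℚ) + Polynomial.X) ^ (Fintype.card α - σ.support.card) *
      (1 - (-Polynomial.X) ^ σ.support.card) := by
  have hfix : (univ.filter fun i => σ i = i).card = Fintype.card α - σ.support.card := by
    rw [← card_compl]
    congr 1
    ext i
    simp
  have hsupp : (univ.filter fun i => ¬ σ i = i).card = σ.support.card := by
    congr 1
  rw [permPoly_eq_sum, sum_eq_add_of_mem 1 σ (mem_univ _) (mem_univ _) hσ.ne_one.symm]
  · have h1 : ∏ i, ((if (1 : Perm α) i = i then (1 : Polynomial ℚ) else 0) +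
        (if (1 : Perm α) i = σ i then Polynomial.X else 0)) =
        (1 + Polynomial.X) ^ (Fintype.card α - σ.support.card) := by
      rw [← hfix, ← prod_const, prod_filter]
      refine prod_congr rfl fun i _ => ?_
      simp only [Perm.one_apply, if_true, eq_comm (a := i)]
      split_ifs <;> simp
    have h2 : ∏ i, ((if σ i = i then (1 : Polynomial ℚ) else 0) +
        (if σ i = σ i then Polynomial.X else 0)) =
        (1 + Polynomial.X) ^ (Fintype.card α - σ.support.card) *
          Polynomial.X ^ σ.support.card := by
      rw [← hfix, ← hsupp, ← prod_const, ← prod_const, prod_filter, prod_filter, ← prod_mul_distrib]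
      refine prod_congr rfl fun i _ => ?_
      simp only [if_true]
      split_ifs <;> simp_all
    rw [h1, h2, hσ.sign, neg_pow (Polynomial.X : Polynomial ℚ)]
    simp only [Perm.sign_one, Units.val_one, Int.cast_one, Units.val_neg, Units.val_pow_eq_pow_val,
      Int.cast_neg, Int.cast_pow]
    ring
  · intro q _ hq
    rw [mul_eq_zero]
    right
    have : ∃ i, ¬ (q i = i ∨ q i = σ i) := by
      by_contra! h
      rcases eq_one_or_eq_of_isCycle hσ h with h | h
      · exact hq.1 h
      · exact hq.2 h
    obtain ⟨i, hi⟩ := this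
    push Not at hi
    refine prod_eq_zero (mem_univ i) ?_
    rw [if_neg hi.1, if_neg hi.2, add_zero]

theorem one_add_X_ne_zero : (1 : Polynomial ℚ) + Polynomial.X ≠ 0 := by
  intro h
  simpa using congrArg (Polynomial.eval 0) h

theorem permPoly_eq_cycleType (u : Perm α) :
    permPoly u = ((1 : Polynomial ℚ) + Polynomial.X) ^ (Fintype.card α - u.support.card) *
      (u.cycleType.map fun c => (1 : Polynomial ℚ) - (-Polynomial.X) ^ c).prod := by
  induction u using Perm.cycle_induction_on with
  | base_one => simp [permPoly_one]
  | base_cycles σ hσ => rw [permPoly_isCycle hσ, hσ.cycleType]; simp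
  | induction_disjoint σ τ h hσ ih1 ih2 =>
    have h1 := permPoly_mul h
    have hcard := h.card_support_mul
    have hle : (σ * τ).support.card ≤ Fintype.card α := card_le_univ _
    refine mul_left_cancel₀ (pow_ne_zero (Fintype.card α) one_add_X_ne_zero) ?_
    rw [← h1, ih1, ih2, h.cycleType_mul, Multiset.map_add, Multiset.prod_add]
    have e : Fintype.card α - σ.support.card + (Fintype.card α - τ.support.card) =
        Fintype.card α + (Fintype.card α - (σ * τ).support.card) := by omega
    rw [mul_mul_mul_comm, ← pow_add, e, pow_add]
    ring

theorem permPoly_eq_partition (u : Perm α) :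
    permPoly u = (u.partition.parts.map fun c => (1 : Polynomial ℚ) - (-Polynomial.X) ^ c).prod := by
  rw [permPoly_eq_cycleType, Perm.parts_partition, Multiset.map_add, Multiset.prod_add, mul_comm]
  simp

/-! ### Principal minors -/

/-- The principal minor of the matrix of the permutation `u` on the subset `Y`. -/
def minor (u : Perm α) (Y : Finset α) : ℚ :=
  ∑ q ∈ permsOn Y, if ∀ y ∈ Y, q y = u y then signValue Perm.sign q else 0

theorem coeff_symm (X : Finset α) (v : Perm α) :
    (weightedSum 1 X).coeff v = if v ∈ permsOn X then 1 else 0 := by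
  rw [weightedSum, coeff_sum, Finsupp.finsetSum_apply]
  simp [Finsupp.single_apply]

/-- A permutation `q` of `Y` contributes when `u * q⁻¹` fixes `Y` pointwise, that is, when `q`
agrees with `u` on `Y`. This is the Leibniz expansion of the minor. -/
theorem coeff_symm_mul_anti (u : Perm α) (Y : Finset α) :
    (weightedSum 1 Yᶜ * weightedSum Perm.sign Y).coeff u = minor u Y := by
  rw [weightedSum.eq_def Perm.sign, mul_sum, coeff_sum, Finsupp.finsetSum_apply, minor]
  refine sum_congr rfl fun q hq => ?_
  rw [coeff_mul_single_apply, coeff_symm, ite_mul, one_mul, zero_mul]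
  congr 1
  rw [mem_permsOn]
  simp only [mem_compl, not_not, eq_iff_iff]
  constructor
  · intro h y hy
    have := h (q y) (apply_mem_of_mem_permsOn hq hy)
    simpa using this.symm
  · intro h y hy
    have hm := apply_mem_of_mem_permsOn (inv_mem_permsOn hq) hy
    have := h _ hm
    rw [Perm.mul_apply, ← this]
    simp

theorem permPoly_eq_sum_minor (u : Perm α) :
    permPoly u = ∑ I : Finset α, Polynomial.C (minor u I) * Polynomial.X ^ I.card := by
  have key : ∀ q : Perm α, ∏ i, ((if q i = i then (1 : Polynomial ℚ) else 0) +
      (if q i = u i then Polynomial.X else 0)) =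
      ∑ I : Finset α, if q ∈ permsOn I then
        (if ∀ y ∈ I, q y = u y then Polynomial.X ^ I.card else 0) else 0 := by
    intro q
    simp_rw [add_comm (ite _ (1 : Polynomial ℚ) 0)]
    rw [Finset.prod_add, powerset_univ]
    refine sum_congr rfl fun I _ => ?_
    rw [prod_ite_zero, prod_ite_zero, prod_const, prod_const_one, mul_comm, ite_mul, one_mul,
      zero_mul]
    congr 1
    · simp [mem_permsOn]
    · congr
  rw [permPoly_eq_sum]
  simp_rw [key, mul_sum]
  rw [sum_comm]
  refine sum_congr rfl fun I _ => ?_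
  rw [minor, map_sum, sum_mul]
  simp_rw [mul_ite, mul_zero]
  rw [← sum_filter, filter_univ_mem]
  refine sum_congr rfl fun q _ => ?_
  split_ifs <;> simp [signValue]

theorem coeff_permPoly (u : Perm α) (k : ℕ) :
    (permPoly u).coeff k = ∑ I ∈ powersetCard k (univ : Finset α), minor u I := by
  rw [permPoly_eq_sum_minor, Polynomial.finsetSum_coeff, powersetCard_eq_filter, powerset_univ,
    sum_filter]
  refine sum_congr rfl fun I _ => ?_
  rw [Polynomial.coeff_C_mul_X_pow]
  simp only [eq_comm]

omit [Fintype α] in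
theorem exists_perm_map [Finite α] {Y I : Finset α} (h : Y.card = I.card) :
    ∃ p : Perm α, Y.map p.toEmbedding = I := by
  classical
  have := Fintype.ofFinite α
  let e : {x // x ∈ Y} ≃ {x // x ∈ I} := Finset.equivOfCardEq h
  refine ⟨e.extendSubtype, eq_of_subset_of_card_le (fun x hx => ?_) (by simp [h])⟩
  obtain ⟨y, hy, rfl⟩ := mem_map.1 hx
  exact e.extendSubtype_mem y hy

theorem permPoly_conj (u h : Perm α) : permPoly (h⁻¹ * u * h) = permPoly u := by
  rw [permPoly_eq_partition, permPoly_eq_partition]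
  congr 3
  rw [← Perm.partition_eq_of_isConj, isConj_iff]
  exact ⟨h, by group⟩

/-- By conjugation the trace depends only on the size of `Y`. Summed over all subsets of that size,
the minors give a coefficient of `permPoly`, a class function; dividing by the binomial coefficient
isolates one subset. -/
theorem classTrace_symm_mul_anti (u : Perm α) (Y : Finset α) :
    classTrace u (weightedSum 1 Yᶜ * weightedSum Perm.sign Y) =
      (Y.card.factorial : ℚ) * (Fintype.card α - Y.card).factorial *
        (permPoly u).coeff Y.card := by
  have h1 : ∀ I ∈ powersetCard Y.card (univ : Finset α),
      classTrace u (weightedSum 1 Iᶜ * weightedSum Perm.sign I) =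
        classTrace u (weightedSum 1 Yᶜ * weightedSum Perm.sign Y) := by
    intro I hI
    obtain ⟨p, rfl⟩ := exists_perm_map (mem_powersetCard.1 hI).2.symm
    rw [← classTrace_map u p 1 Perm.sign Yᶜ Y]
    congr 3
    ext x
    simp
  have h2 : ∑ I ∈ powersetCard Y.card (univ : Finset α),
      classTrace u (weightedSum 1 Iᶜ * weightedSum Perm.sign I) =
        (Fintype.card α).factorial * (permPoly u).coeff Y.card := by
    simp_rw [classTrace_apply, coeff_symm_mul_anti]
    rw [sum_comm]
    simp_rw [← coeff_permPoly, permPoly_conj]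
    rw [sum_const, card_univ, Fintype.card_perm, nsmul_eq_mul]
  rw [sum_congr rfl h1, sum_const, card_powersetCard, card_univ, nsmul_eq_mul] at h2
  have hle : Y.card ≤ Fintype.card α := card_le_univ _
  have h3 := Nat.choose_mul_factorial_mul_factorial hle
  have h4 : ((Fintype.card α).choose Y.card : ℚ) ≠ 0 := by
    exact_mod_cast (Nat.choose_pos hle).ne'
  refine mul_left_cancel₀ h4 ?_
  rw [h2, ← h3]
  push_cast
  ring

/-- The class trace of the Young symmetrizer of a hook. -/
theorem classTrace_hook (u : Perm α) {Q : Polynomial ℚ} (hQ : (1 + Polynomial.X) * Q = permPoly u)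
    (Y : Finset α) (o : α) (ho : o ∉ Y) :
    classTrace u (weightedSum 1 Yᶜ * weightedSum Perm.sign (insert o Y)) =
      (Fintype.card α : ℚ) * (Fintype.card α - Y.card - 1).factorial * Y.card.factorial *
        Q.coeff Y.card := by
  -- The trace is the same for every corner outside `Y`, so the first sum in
  -- `classTrace_hook_relation` has equal terms.
  have hswap : ∀ (Y : Finset α) (o x : α), o ∉ Y → x ∉ Y →
      classTrace u (weightedSum 1 Yᶜ * weightedSum Perm.sign (insert x Y)) =
        classTrace u (weightedSum 1 Yᶜ * weightedSum Perm.sign (insert o Y)) := by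
    intro Y o x ho hx
    have hY : Y.map (swap o x).toEmbedding = Y := by
      refine eq_of_subset_of_card_le (fun z hz => ?_) (by simp)
      obtain ⟨y, hy, rfl⟩ := mem_map.1 hz
      have h1 : y ≠ o := fun h => ho (h ▸ hy)
      have h2 : y ≠ x := fun h => hx (h ▸ hy)
      simpa [swap_apply_of_ne_of_ne h1 h2] using hy
    rw [← classTrace_map u (swap o x) 1 Perm.sign Yᶜ (insert o Y), map_insert, hY]
    congr 3
    · conv_lhs => rw [← hY]
      ext z
      simp
    · simp
  have hrel : ∀ (Y : Finset α) (o : α), o ∉ Y →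
      ((Fintype.card α - Y.card : ℕ) : ℚ) *
        classTrace u (weightedSum 1 Yᶜ * weightedSum Perm.sign (insert o Y)) +
      ∑ y ∈ Y, classTrace u (weightedSum 1 (insert y Yᶜ) * weightedSum Perm.sign Y) =
      Fintype.card α * ((Y.card.factorial : ℚ) * (Fintype.card α - Y.card).factorial *
        (permPoly u).coeff Y.card) := by
    intro Y o ho
    have h1 := classTrace_hook_relation u (X := Yᶜ) (Y := Y) disjoint_compl_left
    rw [sum_congr rfl fun x hx => hswap Y o x ho (mem_compl.1 hx), sum_const, card_compl,
      nsmul_eq_mul, classTrace_symm_mul_anti] at h1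
    rw [h1, Nat.cast_sub (card_le_univ Y), sub_add_cancel]
  induction hk : Y.card generalizing Y o with
  | zero =>
    have h := hrel Y o ho
    obtain rfl := card_eq_zero.1 hk
    have hd : Fintype.card α ≠ 0 := (Fintype.card_pos_iff.2 ⟨o⟩).ne'
    have hd' : (Fintype.card α : ℚ) ≠ 0 := by exact_mod_cast hd
    rw [← hQ] at h
    simp only [card_empty, Nat.sub_zero, sum_empty, add_zero, Polynomial.mul_coeff_zero] at h
    rw [mul_left_cancel₀ hd' h, ← Nat.mul_factorial_pred hd]
    simp
  | succ k ih =>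
    have h := hrel Y o ho
    have hlt : Y.card < Fintype.card α := by
      have := card_le_univ (insert o Y)
      rw [card_insert_of_notMem ho] at this
      omega
    have hy : ∀ y ∈ Y, classTrace u (weightedSum 1 (insert y Yᶜ) * weightedSum Perm.sign Y) =
        (Fintype.card α : ℚ) * (Fintype.card α - k - 1).factorial * k.factorial * Q.coeff k := by
      intro y hy
      have h2 := ih (Y.erase y) y (notMem_erase _ _) (by rw [card_erase_of_mem hy, hk]; rfl)
      rwa [compl_erase, insert_erase hy] at h2
    obtain ⟨m, hm⟩ : ∃ m, Fintype.card α = k + 1 + (m + 1) :=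
      ⟨Fintype.card α - (k + 1) - 1, by omega⟩
    -- The relation gives hooks of leg $k+1$ and $k$ together; the identity
    -- $[X^{k+1}](1+X)Q=Q_{k+1}+Q_k$ splits the right-hand side in the same way.
    rw [sum_congr rfl hy, sum_const, nsmul_eq_mul, hk, ← hQ, add_mul, one_mul,
      Polynomial.coeff_add, Polynomial.coeff_X_mul] at h
    have e1 : Fintype.card α - (k + 1) = m + 1 := by omega
    have e2 : Fintype.card α - k - 1 = m + 1 := by omega
    have e3 : Fintype.card α - (k + 1) - 1 = m := by omega
    rw [e1, e2] at h
    rw [e3]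
    have hm0 : ((m + 1 : ℕ) : ℚ) ≠ 0 := by positivity
    refine mul_left_cancel₀ hm0 ?_
    rw [← eq_sub_iff_add_eq] at h
    rw [h, Nat.factorial_succ m, Nat.factorial_succ k]
    push_cast
    ring

end ClassTrace

/-! ### Characters of left ideals -/

section LeftIdeal

open MonoidAlgebra

variable {d : ℕ}

theorem spechtRep_eq_lsmul (lam : Nat.Partition d) (g : Perm (Fin d)) :
    spechtRep lam g = Algebra.lsmul ℚ ℚ (spechtModule lam)
      (single g 1 : MonoidAlgebra ℚ (Perm (Fin d))) := rfl

/-- The trace of `x ↦ g x c` on the group algebra. -/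
theorem trace_mulLeft_mulRight (g : Perm (Fin d)) (c : MonoidAlgebra ℚ (Perm (Fin d))) :
    LinearMap.trace ℚ (MonoidAlgebra ℚ (Perm (Fin d)))
      (LinearMap.mulLeft ℚ (single g 1) ∘ₗ LinearMap.mulRight ℚ c) = classTrace g⁻¹ c := by
  rw [LinearMap.trace_eq_matrix_trace ℚ (MonoidAlgebra.basis (Perm (Fin d)) ℚ), Matrix.trace,
    classTrace_apply]
  refine sum_congr rfl fun h _ => ?_
  rw [Matrix.diag_apply, LinearMap.toMatrix_apply, MonoidAlgebra.basis_apply]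
  change ((single g 1 : MonoidAlgebra ℚ (Perm (Fin d))) * (single h 1 * c)).coeff h = _
  rw [coeff_single_mul_apply, coeff_single_mul_apply, one_mul, one_mul, mul_assoc]

/-- Right multiplication by $n^{-1}c$ projects the group algebra onto the left ideal generated by
$c$. So the trace of $g$ on the ideal is the trace of $x\mapsto n^{-1}gxc$ on the whole algebra. -/
theorem character_of_quasi_idempotent (lam : Nat.Partition d) {n : ℚ} (hn : n ≠ 0)
    (h : youngSymmetrizer (tableau lam) * youngSymmetrizer (tableau lam) =
      n • youngSymmetrizer (tableau lam)) (g : Perm (Fin d)) :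
    (spechtRep lam).character g = n⁻¹ * classTrace g⁻¹ (youngSymmetrizer (tableau lam)) := by
  set c := youngSymmetrizer (tableau lam) with hc
  let ι : spechtModule lam →ₗ[ℚ] MonoidAlgebra ℚ (Perm (Fin d)) :=
    (spechtModule lam).subtype.restrictScalars ℚ
  let ρ : MonoidAlgebra ℚ (Perm (Fin d)) →ₗ[ℚ] spechtModule lam :=
    { toFun := fun x => ⟨(n⁻¹ • x) * c, Submodule.mem_span_singleton.2 ⟨n⁻¹ • x, rfl⟩⟩
      map_add' := fun x y => Subtype.ext (by simp [add_mul])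
      map_smul' := fun a x => Subtype.ext (by
        change (n⁻¹ • a • x) * c = a • ((n⁻¹ • x) * c)
        rw [smul_comm, smul_mul_assoc]) }
  have hρι : ρ ∘ₗ ι = LinearMap.id := by
    ext1 v
    obtain ⟨v, hv⟩ := v
    obtain ⟨x, rfl⟩ := Submodule.mem_span_singleton.1 hv
    refine Subtype.ext ?_
    change (n⁻¹ • (x * c)) * c = x * c
    rw [smul_mul_assoc, mul_assoc, h, mul_smul_comm, smul_smul, inv_mul_cancel₀ hn, one_smul]
  have h1 : spechtRep lam g = ρ ∘ₗ (LinearMap.mulLeft ℚ (single g 1) ∘ₗ ι) := by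
    have e : LinearMap.mulLeft ℚ (single g 1) ∘ₗ ι = ι ∘ₗ spechtRep lam g := by
      ext1 v
      rfl
    rw [e, ← LinearMap.comp_assoc, hρι, LinearMap.id_comp]
  rw [Representation.character, h1, LinearMap.trace_comp_comm']
  have h2 : (LinearMap.mulLeft ℚ (single g 1) ∘ₗ ι) ∘ₗ ρ =
      n⁻¹ • (LinearMap.mulLeft ℚ (single g 1) ∘ₗ LinearMap.mulRight ℚ c) := by
    refine LinearMap.ext fun x => ?_
    change (single g 1 : MonoidAlgebra ℚ (Perm (Fin d))) * ((n⁻¹ • x) * c) =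
      n⁻¹ • (single g 1 * (x * c))
    rw [smul_mul_assoc, mul_smul_comm]
  rw [h2, map_smul, trace_mulLeft_mulRight, smul_eq_mul]

/-- The hypothesis says that `E` acts as zero on the Specht module; the sum is the trace of this
action. -/
theorem sum_coeff_mul_character (lam : Nat.Partition d) {E : MonoidAlgebra ℚ (Perm (Fin d))}
    (hE : ∀ x, E * x * youngSymmetrizer (tableau lam) = 0) :
    ∑ u : Perm (Fin d), E.coeff u * (spechtRep lam).character u = 0 := by
  have h0 : Algebra.lsmul ℚ ℚ (spechtModule lam) E = 0 := by
    ext1 v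
    obtain ⟨v, hv⟩ := v
    obtain ⟨x, rfl⟩ := Submodule.mem_span_singleton.1 hv
    refine Subtype.ext ?_
    change E * (x * youngSymmetrizer (tableau lam)) = 0
    rw [← mul_assoc, hE]
  have hs : E = ∑ u : Perm (Fin d), E.coeff u • single u 1 := by
    nth_rewrite 1 [← sum_coeff_single E]
    rw [Finsupp.sum_fintype _ _ (by simp)]
    simp [smul_single]
  have h1 := congrArg (LinearMap.trace ℚ (spechtModule lam)) h0
  rw [hs, map_sum, map_sum, map_zero] at h1
  rw [← h1]
  refine sum_congr rfl fun u _ => ?_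
  rw [map_smul, map_smul, smul_eq_mul, ← spechtRep_eq_lsmul]
  rfl

theorem isConj_of_partition_parts {u v : Perm (Fin d)} (h : u.partition.parts = v.partition.parts) :
    IsConj u v :=
  Perm.partition_eq_of_isConj.2 (Nat.Partition.ext h)

theorem character_eq_chi (lam mu : Nat.Partition d) {u : Perm (Fin d)}
    (h : u.partition.parts = mu.parts) : (spechtRep lam).character u = chi lam mu := by
  have h1 : (permOfType mu).partition.parts = mu.parts := (exists_perm_of_type mu).choose_spec
  obtain ⟨c, hc⟩ := isConj_iff.1 (isConj_of_partition_parts (h1.trans h.symm))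
  rw [← hc, Representation.char_conj, chi]

end LeftIdeal

/-! ### Annihilation of Young symmetrizers by hook symmetrizers -/

section Annihilate

open MonoidAlgebra

variable {d : ℕ}

theorem single_mul_sum_of_closed {ε : Perm (Fin d) →* ℤˣ} {S : Finset (Perm (Fin d))}
    {t : Perm (Fin d)} (ht : ∀ p, t * p ∈ S ↔ p ∈ S) :
    single t 1 * ∑ p ∈ S, single p (signValue ε p) =
      signValue ε t • ∑ p ∈ S, single p (signValue ε p) := by
  rw [mul_sum, smul_sum]
  refine sum_nbij' (t * ·) (t⁻¹ * ·) (fun q hq => (ht q).2 hq)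
    (fun q hq => (ht _).1 (by simpa using hq)) (by simp) (by simp) fun q hq => ?_
  rw [single_mul_single, smul_single, signValue_mul, smul_eq_mul, ← mul_assoc,
    signValue_mul_self]

theorem single_mul_rowSymmetrizer {lam : Nat.Partition d} (T : Tableau lam) {x y : Fin d}
    (h : (T x).1.1 = (T y).1.1) :
    single (swap x y) 1 * rowSymmetrizer T = rowSymmetrizer T := by
  classical
  have hs : ∀ z, (T (swap x y z)).1.1 = (T z).1.1 := by
    intro z
    rw [swap_apply_def]
    split_ifs with h1 h2
    · rw [h1, h]
    · rw [h2, h]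
    · rfl
  have := single_mul_sum_of_closed (ε := 1)
    (S := univ.filter fun p : Perm (Fin d) => ∀ x, (T (p x)).1.1 = (T x).1.1) (t := swap x y)
    (by simp [hs])
  simp only [signValue_trivial, one_smul] at this
  rw [rowSymmetrizer]
  convert this

theorem single_mul_colAntisymmetrizer {lam : Nat.Partition d} (T : Tableau lam) {x y : Fin d}
    (hxy : x ≠ y) (h : (T x).1.2 = (T y).1.2) :
    single (swap x y) 1 * colAntisymmetrizer T = -colAntisymmetrizer T := by
  classical
  have hs : ∀ z, (T (swap x y z)).1.2 = (T z).1.2 := by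
    intro z
    rw [swap_apply_def]
    split_ifs with h1 h2
    · rw [h1, h]
    · rw [h2, h]
    · rfl
  have := single_mul_sum_of_closed (ε := Perm.sign)
    (S := univ.filter fun p : Perm (Fin d) => ∀ x, (T (p x)).1.2 = (T x).1.2) (t := swap x y)
    (by simp [hs])
  rw [signValue_sign_swap hxy, neg_one_smul] at this
  simp only [signValue] at this
  rw [colAntisymmetrizer]
  convert this

theorem cell_lt {lam : Nat.Partition d} (T : Tableau lam) (x : Fin d) :
    (T x).1.1 < lam.parts.card ∧ ∃ p ∈ lam.parts, (T x).1.2 < p := by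
  have h : (T x).1 ∈ diagram lam := (T x).2
  obtain ⟨h1, h2⟩ := YoungDiagram.mem_ofRowLens.1 h
  refine ⟨by simpa [rows] using h1, _, ?_, h2⟩
  exact (Multiset.mem_sort _).1 (List.getElem_mem h1)

theorem mul_eq_zero_of_forall_single {z w : MonoidAlgebra ℚ (Perm (Fin d))}
    (h : ∀ u, z * single u 1 * w = 0) (x : MonoidAlgebra ℚ (Perm (Fin d))) : z * x * w = 0 := by
  induction x using MonoidAlgebra.induction_linear with
  | zero => simp
  | add a b ha hb => rw [mul_add, add_mul, ha, hb, add_zero]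
  | single p c =>
    have h1 : (single p c : MonoidAlgebra ℚ (Perm (Fin d))) = c • single p 1 := by
      rw [smul_single, smul_eq_mul, mul_one]
    rw [h1, mul_smul_comm, smul_mul_assoc, h, smul_zero]

theorem symm_mul_colAntisymmetrizer {lam : Nat.Partition d} (T : Tableau lam) {R : Finset (Fin d)}
    (hR : R.Nonempty) (h : ∀ p ∈ lam.parts, p < R.card) (x : MonoidAlgebra ℚ (Perm (Fin d))) :
    weightedSum 1 R * x * colAntisymmetrizer T = 0 := by
  refine mul_eq_zero_of_forall_single (fun u => ?_) x
  have hR := hR.card_pos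
  -- Pigeonhole on columns. A column index is below a part that is itself below `R.card`, hence
  -- below `R.card - 1`, which is one less than the number of entries.
  obtain ⟨a, ha, b, hb, hab, hT⟩ := exists_ne_map_eq_of_card_lt_of_maps_to
    (s := R) (t := range (R.card - 1)) (f := fun z => (T (u⁻¹ z)).1.2) (by simp; omega)
    (fun z _ => by
      obtain ⟨p, hp, hlt⟩ := (cell_lt T (u⁻¹ z)).2
      have := h p hp
      simp only [coe_range, Set.mem_Iio]
      omega)
  have hu : ∀ z, u (u⁻¹ z) = z := fun z => by simp
  refine mul_eq_zero_of_swap (t := swap (u⁻¹ a) (u⁻¹ b)) (a := 1) (b := -1) (by norm_num) ?_ ?_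
  · rw [← swap_apply_apply, hu, hu, weightedSum_mul_single _ (swap_mem_permsOn ha hb),
      signValue_trivial]
  · rw [neg_one_smul]
    exact single_mul_colAntisymmetrizer T (fun h => hab (u⁻¹.injective h)) hT

theorem anti_mul_rowSymmetrizer {lam : Nat.Partition d} (T : Tableau lam) {C : Finset (Fin d)}
    (h : lam.parts.card < C.card) (x : MonoidAlgebra ℚ (Perm (Fin d))) :
    weightedSum Perm.sign C * x * rowSymmetrizer T = 0 := by
  refine mul_eq_zero_of_forall_single (fun u => ?_) x
  obtain ⟨a, ha, b, hb, hab, hT⟩ := exists_ne_map_eq_of_card_lt_of_maps_to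
    (s := C) (t := range lam.parts.card) (f := fun z => (T (u⁻¹ z)).1.1) (by simpa using h)
    (fun z _ => by simpa using (cell_lt T (u⁻¹ z)).1)
  have hu : ∀ z, u (u⁻¹ z) = z := fun z => by simp
  refine mul_eq_zero_of_swap (t := swap (u⁻¹ a) (u⁻¹ b)) (a := -1) (b := 1) (by norm_num) ?_ ?_
  · rw [← swap_apply_apply, hu, hu, weightedSum_mul_single _ (swap_mem_permsOn ha hb),
      signValue_sign_swap hab]
  · rw [one_smul]
    exact single_mul_rowSymmetrizer T hT

theorem hook_mul_youngSymmetrizer {lam : Nat.Partition d} (T : Tableau lam) {R C : Finset (Fin d)}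
    (hR : R.Nonempty) (h : lam.parts.card < C.card ∨ ∀ p ∈ lam.parts, p < R.card)
    (x : MonoidAlgebra ℚ (Perm (Fin d))) :
    weightedSum 1 R * weightedSum Perm.sign C * x * youngSymmetrizer T = 0 := by
  rw [youngSymmetrizer]
  rcases h with h | h
  · rw [← mul_assoc, mul_assoc _ _ x, mul_assoc _ _ (rowSymmetrizer T),
      anti_mul_rowSymmetrizer T h, mul_zero, zero_mul]
  · have := symm_mul_colAntisymmetrizer T hR h (weightedSum Perm.sign C * x * rowSymmetrizer T)
    rw [← this]
    simp only [mul_assoc]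

end Annihilate

/-! ### The generating polynomial of hook characters -/

section HookPoly

open MonoidAlgebra

variable {α : Type*} [Fintype α] [DecidableEq α]

/-- The quotient of `det (1 + X P)` by `1 + X`, where `P` is the matrix of the permutation `u`. -/
def hookPoly (u : Perm α) : Polynomial ℚ :=
  permPoly u /ₘ (Polynomial.X - Polynomial.C (-1))

theorem exists_partition_cons [Nonempty α] (u : Perm α) :
    ∃ c s, u.partition.parts = c ::ₘ s := by
  have : u.partition.parts ≠ 0 := by
    intro h
    have h1 := u.partition.parts_sum
    rw [h, Multiset.sum_zero] at h1
    exact Fintype.card_ne_zero h1.symm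
  obtain ⟨c, hc⟩ := Multiset.exists_mem_of_ne_zero this
  exact ⟨c, _, (Multiset.cons_erase hc).symm⟩

theorem one_add_X_mul_hookPoly [Nonempty α] (u : Perm α) :
    (1 + Polynomial.X) * hookPoly u = permPoly u := by
  have h : (permPoly u).IsRoot (-1) := by
    obtain ⟨c, s, hs⟩ := exists_partition_cons u
    rw [permPoly_eq_partition, hs, Polynomial.IsRoot]
    simp
  have h1 := Polynomial.mul_divByMonic_eq_iff_isRoot.2 h
  rw [hookPoly]
  nth_rewrite 2 [← h1]
  congr 1
  simp [add_comm]

theorem natDegree_permPoly_le (u : Perm α) : (permPoly u).natDegree ≤ Fintype.card α := by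
  rw [permPoly_eq_sum_minor]
  refine Polynomial.natDegree_sum_le_of_forall_le _ _ fun I _ => ?_
  exact (Polynomial.natDegree_C_mul_X_pow_le _ _).trans (card_le_univ I)

theorem natDegree_hookPoly_lt [Nonempty α] (u : Perm α) :
    (hookPoly u).natDegree < Fintype.card α := by
  have h := Polynomial.natDegree_divByMonic (permPoly u) (Polynomial.monic_X_sub_C (-1 : ℚ))
  rw [Polynomial.natDegree_X_sub_C] at h
  have h1 := natDegree_permPoly_le u
  have h2 : 0 < Fintype.card α := Fintype.card_pos
  rw [hookPoly, h]
  omega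

theorem hookPoly_eq_of_parts_cons [Nonempty α] (u : Perm α) {c : ℕ} {s : Multiset ℕ}
    (h : u.partition.parts = c ::ₘ s) :
    hookPoly u = (∑ i ∈ range c, (-Polynomial.X) ^ i) *
      (s.map fun c => (1 : Polynomial ℚ) - (-Polynomial.X) ^ c).prod := by
  refine mul_left_cancel₀ one_add_X_ne_zero ?_
  rw [one_add_X_mul_hookPoly, permPoly_eq_partition, h, Multiset.map_cons, Multiset.prod_cons,
    ← mul_assoc, ← mul_neg_geom_sum, sub_neg_eq_add]

/-- At $X=-1$ one part contributes a geometric sum equal to itself, and every other part a factor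
$0$. This is how long cycles are detected in `chi_nonhook`. -/
theorem eval_hookPoly [Nonempty α] (u : Perm α) :
    (hookPoly u).eval (-1) =
      if u.partition.parts = {Fintype.card α} then (Fintype.card α : ℚ) else 0 := by
  obtain ⟨c, s, hs⟩ := exists_partition_cons u
  rw [hookPoly_eq_of_parts_cons u hs]
  rcases s.empty_or_exists_mem with rfl | ⟨a, ha⟩
  · have hc : c = Fintype.card α := by
      have := u.partition.parts_sum
      rw [hs] at this
      simpa using this
    rw [if_pos (by rw [hs, hc]; rfl)]
    simp [Polynomial.eval_finsetSum, hc]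
  · rw [if_neg, Polynomial.eval_mul]
    · obtain ⟨t, rfl⟩ := Multiset.exists_cons_of_mem ha
      simp
    · rw [hs]
      intro h
      have := congrArg Multiset.card h
      have h0 := Multiset.card_pos_iff_exists_mem.2 ⟨a, ha⟩
      simp at this
      simp [this] at h0

theorem hookPoly_inv (u : Perm α) : hookPoly u⁻¹ = hookPoly u := by
  have : u⁻¹.partition.parts = u.partition.parts := by
    rw [Perm.parts_partition, Perm.parts_partition, Perm.cycleType_inv, Perm.support_inv]
  rw [hookPoly, hookPoly, permPoly_eq_partition, permPoly_eq_partition, this]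

theorem coeff_hookPoly_of_card [Nonempty α] {u : Perm α} (h : u.partition.parts = {Fintype.card α})
    {k : ℕ} (hk : k < Fintype.card α) : (hookPoly u).coeff k = (-1) ^ k := by
  rw [hookPoly_eq_of_parts_cons u (c := Fintype.card α) (s := 0) h, Multiset.map_zero,
    Multiset.prod_zero, mul_one, Polynomial.finsetSum_coeff, sum_eq_single k]
  · rw [neg_pow, ← Polynomial.C_1, ← Polynomial.C_neg, ← Polynomial.C_pow,
      Polynomial.coeff_C_mul_X_pow, if_pos rfl]
  · intro i _ hi
    rw [neg_pow, ← Polynomial.C_1, ← Polynomial.C_neg, ← Polynomial.C_pow,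
      Polynomial.coeff_C_mul_X_pow, if_neg hi.symm]
  · intro h1
    exact absurd (mem_range.2 hk) h1

end HookPoly

/-! ### Hook partitions -/

section Hook

open MonoidAlgebra

variable {d : ℕ}

/-- The hook partition `(d - k, 1, …, 1)` of `d` with `k + 1` parts. -/
def hook (k : Fin d) : Nat.Partition d where
  parts := (d - k) ::ₘ Multiset.replicate k 1
  parts_pos := by
    intro i hi
    rcases Multiset.mem_cons.1 hi with rfl | h
    · have := k.2
      omega
    · rw [Multiset.eq_of_mem_replicate h]
      exact one_pos
  parts_sum := by
    simp

theorem hook_injective : Function.Injective (hook : Fin d → Nat.Partition d) := by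
  intro k l h
  have := congrArg (fun p => p.parts.card) h
  simp [hook] at this
  exact Fin.ext this

theorem rows_hook (k : Fin d) : rows (hook k) = (d - k) :: List.replicate k 1 := by
  have hk := k.2
  have h1 : ((d - k) :: List.replicate k 1 : List ℕ).Pairwise (· ≥ ·) := by
    rw [List.pairwise_cons]
    refine ⟨fun a ha => ?_, List.pairwise_replicate.2 (Or.inr le_rfl)⟩
    rw [List.eq_of_mem_replicate ha]
    omega
  refine List.Perm.eq_of_pairwise' (Multiset.pairwise_sort _ _) h1 ?_
  rw [← Multiset.coe_eq_coe, rows, Multiset.sort_eq, ← Multiset.cons_coe, Multiset.coe_replicate]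
  rfl

theorem mem_diagram_hook (k : Fin d) (c : ℕ × ℕ) :
    c ∈ diagram (hook k) ↔ (c.1 = 0 ∧ c.2 < d - k) ∨ (c.2 = 0 ∧ c.1 ≤ k) := by
  have hk := k.2
  rw [diagram, YoungDiagram.mem_ofRowLens]
  simp only [rows_hook]
  rcases c with ⟨i, j⟩
  rcases i with _ | i
  · simp
    omega
  · simp
    omega

/-- A row of length at least $d-k$ and at least $k$ further rows already use up all $d$ cells. -/
theorem eq_hook_of_card_le {lam : Nat.Partition d} {k : Fin d} {p : ℕ} (hp : p ∈ lam.parts)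
    (hp' : d - k ≤ p) (hk : k + 1 ≤ lam.parts.card) : lam = hook k := by
  obtain ⟨s, hs⟩ := Multiset.exists_cons_of_mem hp
  have hsum := lam.parts_sum
  rw [hs, Multiset.sum_cons] at hsum
  rw [hs, Multiset.card_cons] at hk
  have hpos : ∀ a ∈ s, 1 ≤ a := fun a ha => lam.parts_pos (hs ▸ Multiset.mem_cons_of_mem ha)
  have hle : s.card ≤ s.sum := by
    simpa using Multiset.card_nsmul_le_sum hpos
  have hkd := k.2
  have hsk : s.card = k := by omega
  have hss : s.sum = s.card := by omega
  have hone : ∀ a ∈ s, a = 1 := by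
    intro a ha
    obtain ⟨t, rfl⟩ := Multiset.exists_cons_of_mem ha
    have h1 : t.card ≤ t.sum := by
      simpa using Multiset.card_nsmul_le_sum (s := t) (a := 1)
        (fun b hb => hpos b (Multiset.mem_cons_of_mem hb))
    rw [Multiset.sum_cons, Multiset.card_cons] at hss
    have := hpos a ha
    omega
  refine Nat.Partition.ext ?_
  rw [hs, Multiset.eq_replicate_card.2 hone, hsk]
  change _ = (d - k) ::ₘ Multiset.replicate k 1
  congr 1
  omega

theorem nonhook_bound {lam : Nat.Partition d} (h : lam ∉ Set.range hook) (k : Fin d) :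
    lam.parts.card < k + 1 ∨ ∀ p ∈ lam.parts, p < d - k := by
  by_contra! hc
  obtain ⟨h1, p, hp, h2⟩ := hc
  exact h ⟨k, (eq_hook_of_card_le hp h2 h1).symm⟩

/-- The Young symmetrizer of a hook in terms of its first row and first column. -/
theorem exists_youngSymmetrizer_hook (k : Fin d) : ∃ (o : Fin d) (Y : Finset (Fin d)),
    o ∉ Y ∧ Y.card = k ∧
      youngSymmetrizer (tableau (hook k)) = weightedSum 1 Yᶜ * weightedSum Perm.sign (insert o Y) := by
  classical
  set T := tableau (hook k) with hT
  have hk := k.2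
  have hmem : ∀ x, ((T x).1.1 = 0 ∧ (T x).1.2 < d - k) ∨ ((T x).1.2 = 0 ∧ (T x).1.1 ≤ k) :=
    fun x => (mem_diagram_hook k _).1 (T x).2
  have hext : ∀ x y, (T x).1.1 = (T y).1.1 → (T x).1.2 = (T y).1.2 → x = y := fun x y h1 h2 =>
    T.injective (Subtype.ext (Prod.ext h1 h2))
  have hoc : ((0, 0) : ℕ × ℕ) ∈ (diagram (hook k)).cells :=
    (mem_diagram_hook k _).2 (Or.inr ⟨rfl, Nat.zero_le _⟩)
  set o : Fin d := T.symm ⟨(0, 0), hoc⟩ with ho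
  have hTo : (T o).1 = (0, 0) := by rw [ho, Equiv.apply_symm_apply]
  -- `o` is the corner entry and `Y` the leg, so `Yᶜ` is the first row and `insert o Y` the first
  -- column.
  set Y : Finset (Fin d) := univ.filter fun x => (T x).1.1 ≠ 0 with hY
  refine ⟨o, Y, by simp [hY, hTo], ?_, ?_⟩
  · have h1 : Yᶜ.card = d - k := by
      rw [← card_range (d - k)]
      refine card_nbij (fun x => (T x).1.2) (fun x hx => ?_) (fun x hx y hy h => ?_) fun j hj => ?_
      · have h0 : (T x).1.1 = 0 := by simpa [hY] using hx
        have := hmem x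
        simp only [coe_range, Set.mem_Iio]
        omega
      · have hx0 : (T x).1.1 = 0 := by simpa [hY] using hx
        have hy0 : (T y).1.1 = 0 := by simpa [hY] using hy
        exact hext x y (hx0.trans hy0.symm) h
      · have hjc : ((0, j) : ℕ × ℕ) ∈ (diagram (hook k)).cells :=
          (mem_diagram_hook k _).2 (Or.inl ⟨rfl, by simpa using hj⟩)
        exact ⟨T.symm ⟨(0, j), hjc⟩, by simp [hY]⟩
    have h3 := card_compl Y
    rw [Fintype.card_fin] at h3
    have h4 := card_le_univ Y
    rw [Fintype.card_fin] at h4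
    omega
  · rw [youngSymmetrizer]
    congr 1
    · rw [rowSymmetrizer, weightedSum]
      simp only [signValue_trivial]
      refine sum_congr ?_ fun _ _ => rfl
      ext p
      simp only [mem_filter, mem_univ, true_and, mem_permsOn, mem_compl, not_not, hY]
      constructor
      · intro h x hx
        have h1 := hmem x
        have h2 := hmem (p x)
        have h3 := h x
        exact hext _ _ h3 (by omega)
      · intro h x
        by_cases hx : (T x).1.1 = 0
        · by_contra h1
          rw [hx] at h1
          have h2 := p.injective (h _ h1)
          exact h1 (by rw [h2, hx])
        · rw [h x hx]
    · rw [colAntisymmetrizer, weightedSum]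
      refine sum_congr ?_ fun _ _ => rfl
      ext p
      simp only [mem_filter, mem_univ, true_and, mem_permsOn, mem_insert, not_or, not_not, hY]
      have hcol : ∀ x, (T x).1.1 = 0 → (T x).1.2 = 0 → x = o := fun x h1 h2 =>
        hext x o (by rw [h1, hTo]) (by rw [h2, hTo])
      constructor
      · rintro h x ⟨hxo, hx⟩
        have h0 : (T x).1.2 ≠ 0 := fun h0 => hxo (hcol x hx h0)
        have h2 := hmem (p x)
        have h3 := h x
        exact hext _ _ (by omega) h3
      · intro h x
        by_cases hx : (T x).1.2 = 0
        · by_contra h1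
          rw [hx] at h1
          have h4 : (T (p x)).1.1 = 0 := by
            have := hmem (p x)
            omega
          have h5 : p x ≠ o := fun h5 => h1 (by rw [h5, hTo])
          have h2 := p.injective (h _ ⟨h5, h4⟩)
          exact h1 (by rw [h2, hx])
        · have h4 : (T x).1.1 = 0 := by
            have := hmem x
            omega
          rw [h x ⟨fun h5 => hx (by rw [h5, hTo]), h4⟩]

/-- The constant $(d-k-1)!\,k!\,d$ from `hook_sq` is exactly the factor in `classTrace_hook`, so the
two cancel. -/
theorem chi_hook (k : Fin d) (mu : Nat.Partition d) :
    chi (hook k) mu = (hookPoly (permOfType mu)).coeff k := by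
  obtain ⟨o, Y, ho, hYk, hc⟩ := exists_youngSymmetrizer_hook k
  have hne : Nonempty (Fin d) := ⟨k⟩
  have hk := k.2
  set R := (insert o Y)ᶜ with hR
  have hRins : insert o R = Yᶜ := by
    rw [hR, compl_insert, insert_erase (mem_compl.2 ho)]
  have hRcard : R.card = d - k - 1 := by
    rw [hR, card_compl, card_insert_of_notMem ho, hYk, Fintype.card_fin]
    omega
  have hsq := hook_sq (R := R) (C := Y) (o := o) (by simp [hR]) ho (by
    rw [hR, compl_insert]
    exact (disjoint_compl_left).mono_left (erase_subset _ _))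
  rw [hRins, ← hc, hRcard, hYk] at hsq
  have hd : ((d - k - 1 : ℕ) : ℚ) + (k : ℕ) + 1 = d := by
    have : d - k - 1 + k + 1 = d := by omega
    exact_mod_cast this
  rw [hd] at hsq
  have hd0 : (d : ℚ) ≠ 0 := by
    have : d ≠ 0 := by omega
    exact_mod_cast this
  have hn : ((d - k - 1).factorial : ℚ) * (k : ℕ).factorial * d ≠ 0 := by positivity
  rw [chi, character_of_quasi_idempotent _ hn hsq, hc,
    classTrace_hook _ (one_add_X_mul_hookPoly _) Y o ho, hYk, Fintype.card_fin, hookPoly_inv]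
  field_simp

/-! ### Vanishing of non-hook characters on long cycles -/

theorem sum_conj_coeff (c : MonoidAlgebra ℚ (Perm (Fin d))) (u : Perm (Fin d)) :
    (∑ h : Perm (Fin d), single h 1 * c * single h⁻¹ 1).coeff u = classTrace u c := by
  rw [coeff_sum, Finsupp.finsetSum_apply, classTrace_apply]
  refine sum_congr rfl fun h _ => ?_
  rw [coeff_mul_single_apply, coeff_single_mul_apply]
  simp [mul_assoc]

theorem parts_indiscrete (hd : 0 < d) : (Nat.Partition.indiscrete d).parts = {d} :=
  Nat.Partition.indiscrete_parts hd.ne'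

/-- The characters of non-hook shape vanish on long cycles. -/
theorem chi_nonhook {lam : Nat.Partition d} (h : lam ∉ Set.range hook) (hd : 0 < d) :
    chi lam (Nat.Partition.indiscrete d) = 0 := by
  have hne : Nonempty (Fin d) := ⟨⟨0, hd⟩⟩
  -- The weights are chosen so that the coefficient of `E` at `u` is $\sum_k(-1)^kQ_k$, the value of
  -- `hookPoly u` at $-1$. Thus `E` is $d$ times the sum of the long cycles.
  set E : MonoidAlgebra ℚ (Perm (Fin d)) :=
    ∑ k : Fin d, ((-1) ^ (k : ℕ) * ((d : ℚ) * (d - k - 1).factorial * (k : ℕ).factorial)⁻¹) •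
      ∑ h : Perm (Fin d), single h 1 * youngSymmetrizer (tableau (hook k)) * single h⁻¹ 1 with hE
  have hE0 : ∀ x, E * x * youngSymmetrizer (tableau lam) = 0 := by
    intro x
    rw [hE, sum_mul, sum_mul]
    refine sum_eq_zero fun k _ => ?_
    rw [smul_mul_assoc, smul_mul_assoc, sum_mul, sum_mul, sum_eq_zero, smul_zero]
    intro u _
    obtain ⟨o, Y, ho, hYk, hc⟩ := exists_youngSymmetrizer_hook k
    have hYc : Yᶜ.card = d - k := by rw [card_compl, hYk, Fintype.card_fin]
    have := hook_mul_youngSymmetrizer (tableau lam) (R := Yᶜ) (C := insert o Y)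
      ⟨o, mem_compl.2 ho⟩ (by
        rw [card_insert_of_notMem ho, hYk, hYc]
        exact nonhook_bound h k) (single u⁻¹ 1 * x)
    rw [← hc] at this
    calc _ = single u 1 * (youngSymmetrizer (tableau (hook k)) * (single u⁻¹ 1 * x) *
          youngSymmetrizer (tableau lam)) := by simp only [mul_assoc]
      _ = 0 := by rw [this, mul_zero]
  have hEc : ∀ u, E.coeff u = if u.partition.parts = {d} then (d : ℚ) else 0 := by
    intro u
    have h1 := eval_hookPoly u
    simp only [Fintype.card_fin] at h1
    rw [← h1, Polynomial.eval_eq_sum_range' (n := d) (by simpa using natDegree_hookPoly_lt u), hE,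
      coeff_sum, Finsupp.finsetSum_apply, ← Fin.sum_univ_eq_sum_range
        (fun i => (hookPoly u).coeff i * (-1) ^ i)]
    refine sum_congr rfl fun k _ => ?_
    obtain ⟨o, Y, ho, hYk, hc⟩ := exists_youngSymmetrizer_hook k
    rw [coeff_smul_apply, sum_conj_coeff, hc,
      classTrace_hook _ (one_add_X_mul_hookPoly _) Y o ho, hYk, Fintype.card_fin, smul_eq_mul]
    have hd0 : (d : ℚ) ≠ 0 := by exact_mod_cast hd.ne'
    have h2 : ((d - k - 1).factorial : ℚ) ≠ 0 := by positivity
    have h3 : ((k : ℕ).factorial : ℚ) ≠ 0 := by positivity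
    field_simp
  have hsum := sum_coeff_mul_character lam hE0
  have h2 : ∀ u : Perm (Fin d), E.coeff u * (spechtRep lam).character u =
      (if u.partition.parts = {d} then (d : ℚ) else 0) *
        chi lam (Nat.Partition.indiscrete d) := by
    intro u
    rw [hEc]
    split_ifs with hu
    · rw [character_eq_chi lam (Nat.Partition.indiscrete d) (by rw [hu, parts_indiscrete hd])]
    · simp
  rw [sum_congr rfl fun u _ => h2 u, ← sum_mul, mul_eq_zero] at hsum
  refine hsum.resolve_left (ne_of_gt ?_)
  obtain ⟨u, hu⟩ := exists_perm_of_type (Nat.Partition.indiscrete d)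
  refine sum_pos' (fun v _ => by split_ifs <;> positivity) ⟨u, mem_univ _, ?_⟩
  rw [if_pos (hu.trans (parts_indiscrete hd))]
  exact_mod_cast hd

theorem chi_hook_indiscrete (k : Fin d) :
    chi (hook k) (Nat.Partition.indiscrete d) = (-1) ^ (k : ℕ) := by
  have hne : Nonempty (Fin d) := ⟨k⟩
  have hd : 0 < d := Nat.pos_of_ne_zero fun h => by have := k.2; omega
  have h1 : (permOfType (Nat.Partition.indiscrete d)).partition.parts = {d} := by
    rw [← parts_indiscrete hd]
    exact (exists_perm_of_type _).choose_spec
  rw [chi_hook, coeff_hookPoly_of_card (by simpa using h1) (by simp)]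

/-! ### Power sums of hooks and reduction to a sum over hooks -/

theorem sum_get_cons_replicate (f : ℕ → ℕ → ℚ) (a m : ℕ) {L : List ℕ}
    (h : L = a :: List.replicate m 1) :
    ∑ i : Fin L.length, f (L.get i) i = f a 0 + ∑ i : Fin m, f 1 (i + 1) := by
  subst h
  change ∑ i : Fin ((List.replicate m 1).length + 1), f ((a :: List.replicate m 1).get i) i = _
  rw [Fin.sum_univ_succ]
  congr 1
  refine Fintype.sum_equiv (finCongr (List.length_replicate ..)) _ _ fun i => ?_
  simp

/-- The rows of length one telescope, leaving $A^3+B^3$ with $A=d-k-\frac12$ and $B=k+\frac12$.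
Since $A+B=d$, this is $d\big(\frac{d^2}4+3(\frac{B-A}2)^2\big)$. -/
theorem shiftedPowerSum_hook (k : Fin d) :
    shiftedPowerSum 3 (hook k) / ((2 + 1).factorial : ℚ) =
      (d : ℚ) / 2 * ((((k : ℕ) : ℚ) - ((d : ℚ) - 1) / 2) ^ 2 + (d : ℚ) ^ 2 / 12) := by
  have hk := k.2
  have key : ∀ m : ℕ, ∑ i : Fin m, (((1 : ℚ) - ((i : ℕ) + 1 + 1) + 1 / 2) ^ 3 -
      (-((i : ℕ) + 1 + 1) + 1 / 2) ^ 3) = ((m : ℚ) + 1 / 2) ^ 3 - 1 / 8 := by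
    intro m
    induction m with
    | zero => norm_num
    | succ m ih =>
      rw [Fin.sum_univ_castSucc]
      simp only [Fin.val_castSucc, Fin.val_last]
      rw [ih]
      push_cast
      ring
  have h1 := sum_get_cons_replicate (fun a i : ℕ => ((a : ℚ) - ((i : ℚ) + 1) + 1 / 2) ^ 3 -
    (-((i : ℚ) + 1) + 1 / 2) ^ 3) (d - k) k (rows_hook k)
  have h2 := key k
  push_cast [Nat.cast_sub hk.le] at h1
  rw [h2] at h1
  rw [shiftedPowerSum, h1]
  norm_num [Nat.factorial]
  ring

/-- The sum over all partitions in a one-part double Hurwitz number is a sum over hooks. -/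
theorem sum_chi_eq (hd : 0 < d) (s : ℕ) (mu : Nat.Partition d) :
    ∑ lam : Nat.Partition d, chi lam (Nat.Partition.indiscrete d) *
      (shiftedPowerSum 3 lam / ((2 + 1).factorial : ℚ)) ^ s * chi lam mu =
    ∑ k ∈ range d, (-1) ^ k * ((d : ℚ) / 2 * ((k - ((d : ℚ) - 1) / 2) ^ 2 + (d : ℚ) ^ 2 / 12)) ^ s *
      (hookPoly (permOfType mu)).coeff k := by
  rw [← Fin.sum_univ_eq_sum_range (fun k : ℕ => (-1) ^ k *
    ((d : ℚ) / 2 * ((k - ((d : ℚ) - 1) / 2) ^ 2 + (d : ℚ) ^ 2 / 12)) ^ s *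
      (hookPoly (permOfType mu)).coeff k)]
  symm
  refine Fintype.sum_of_injective hook hook_injective _ _ (fun lam h => ?_) fun k => ?_
  · rw [chi_nonhook h hd, zero_mul, zero_mul]
  · rw [chi_hook_indiscrete, shiftedPowerSum_hook, chi_hook]

end Hook

/-! ### The generating series of hook character sums -/

section Series

open PowerSeries

/-- The power series `exp (c u)`. -/
def expSeries (c : ℚ) : PowerSeries ℚ := rescale c (exp ℚ)

/-- The power series `exp (c u / 2) - exp (-c u / 2)`. -/
def sinhSeries (c : ℚ) : PowerSeries ℚ := expSeries (c / 2) - expSeries (-(c / 2))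

/-- The power series `(exp (u / 2) - exp (-u / 2)) / u`. -/
def sinhQuotient : PowerSeries ℚ := mk fun j => coeff (j + 1) (sinhSeries 1)

theorem expSeries_add (a b : ℚ) : expSeries (a + b) = expSeries a * expSeries b :=
  (exp_mul_exp_eq_exp_add a b).symm

theorem expSeries_zero : expSeries 0 = 1 := by
  simp [expSeries]

theorem expSeries_natCast (k : ℕ) : expSeries k = expSeries 1 ^ k := by
  induction k with
  | zero => simp [expSeries_zero]
  | succ k ih => rw [Nat.cast_succ, expSeries_add, ih, pow_succ]

theorem expSeries_sum {ι : Type*} (s : Finset ι) (f : ι → ℚ) :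
    expSeries (∑ i ∈ s, f i) = ∏ i ∈ s, expSeries (f i) := by
  classical
  induction s using Finset.induction_on with
  | empty => simp [expSeries_zero]
  | insert a s ha ih => rw [sum_insert ha, prod_insert ha, expSeries_add, ih]

theorem coeff_expSeries (c : ℚ) (j : ℕ) : coeff j (expSeries c) = c ^ j / j.factorial := by
  simp [expSeries, coeff_rescale, coeff_exp, div_eq_mul_inv]

theorem constantCoeff_sinhQuotient : constantCoeff sinhQuotient = 1 := by
  rw [← coeff_zero_eq_constantCoeff_apply, sinhQuotient, coeff_mk, sinhSeries, map_sub,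
    coeff_expSeries, coeff_expSeries]
  norm_num

theorem sinhSeries_eq (c : ℚ) : sinhSeries c = C c * X * rescale c sinhQuotient := by
  ext j
  rw [mul_assoc, coeff_C_mul]
  rcases j with _ | j
  · rw [sinhSeries, map_sub, coeff_expSeries, coeff_expSeries]
    simp
  · rw [coeff_succ_X_mul, coeff_rescale, sinhQuotient, coeff_mk, sinhSeries, sinhSeries, map_sub,
      map_sub, coeff_expSeries, coeff_expSeries, coeff_expSeries, coeff_expSeries, neg_pow (c / 2),
      neg_pow ((1 : ℚ) / 2), div_pow, div_pow]
    ring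

/-- The generating series of the signed hook character values in terms of centered contents. -/
def hookSeries (d : ℕ) (Q : Polynomial ℚ) : PowerSeries ℚ :=
  ∑ k ∈ range d, C ((-1) ^ k * Q.coeff k) * expSeries (k - ((d : ℚ) - 1) / 2)

/-- Substitute $X=-e^u$ in `hQ` and multiply by $e^{-du/2}$ to make each factor antisymmetric. The
sign $(-1)^n$ on the right matches the single sign on the left because $n$ is odd. -/
theorem hookSeries_mul {n : ℕ} (hn : Odd n) (beta : Fin n → ℕ) {Q : Polynomial ℚ}
    (hQ : (1 + Polynomial.X) * Q = ∏ i, (1 - (-Polynomial.X) ^ beta i))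
    (hdeg : Q.natDegree < ∑ i, beta i) :
    hookSeries (∑ i, beta i) Q * sinhSeries 1 = ∏ i, sinhSeries (beta i) := by
  set d := ∑ i, beta i with hd
  have h1 : (1 - expSeries 1) * ∑ k ∈ range d, C ((-1) ^ k * Q.coeff k) * expSeries 1 ^ k =
      ∏ i, (1 - expSeries 1 ^ beta i) := by
    have h := congrArg (Polynomial.aeval (-expSeries 1)) hQ
    rw [map_mul, map_prod, Polynomial.aeval_eq_sum_range' hdeg] at h
    simp only [map_add, map_sub, map_one, map_pow, map_neg, Polynomial.aeval_X, neg_neg] at h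
    rw [← h, ← sub_eq_add_neg]
    congr 1
    refine sum_congr rfl fun k _ => ?_
    rw [neg_pow (expSeries 1), smul_eq_C_mul, map_mul, map_pow, map_neg, map_one]
    ring
  have h2 : ∀ c : ℚ, expSeries (-(c / 2)) * (1 - expSeries c) = -sinhSeries c := by
    intro c
    have : expSeries (c / 2) = expSeries (-(c / 2)) * expSeries c := by
      rw [← expSeries_add]
      congr 1
      ring
    rw [sinhSeries, this]
    ring
  have h3 : hookSeries d Q = expSeries (-(((d : ℚ) - 1) / 2)) *
      ∑ k ∈ range d, C ((-1) ^ k * Q.coeff k) * expSeries 1 ^ k := by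
    rw [hookSeries, mul_sum]
    refine sum_congr rfl fun k _ => ?_
    rw [sub_eq_add_neg, expSeries_add, expSeries_natCast]
    ring
  have h4 : expSeries (-(((d : ℚ) - 1) / 2)) * expSeries (-(1 / 2)) =
      ∏ i, expSeries (-((beta i : ℚ) / 2)) := by
    rw [← expSeries_add, ← expSeries_sum, hd]
    congr 1
    rw [sum_neg_distrib, ← sum_div]
    push_cast
    ring
  have h5 : ∏ i, (expSeries (-((beta i : ℚ) / 2)) * (1 - expSeries (beta i))) =
      -∏ i, sinhSeries (beta i) := by
    simp_rw [h2]
    rw [prod_neg, card_univ, Fintype.card_fin, hn.neg_one_pow]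
    ring
  have h6 : hookSeries d Q * (expSeries (-(1 / 2)) * (1 - expSeries 1)) =
      ∏ i, (expSeries (-((beta i : ℚ) / 2)) * (1 - expSeries (beta i))) := by
    simp_rw [prod_mul_distrib, expSeries_natCast]
    rw [← h1, ← h4, h3]
    ring
  rw [h5, h2, mul_neg, neg_inj] at h6
  exact h6

/-- The power series `∏ S(x_i u) / S(u)` where `S(u) = (exp (u / 2) - exp (-u / 2)) / u`. -/
def sinhRatio {n : ℕ} (x : Fin n → ℚ) : PowerSeries ℚ :=
  (∏ i, rescale (x i) sinhQuotient) * sinhQuotient⁻¹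

/-- Each hyperbolic sine has a factor $u$; one of the $2r+1$ on the right cancels against the one on
the left. -/
theorem hookSeries_eq {r : ℕ} (beta : Fin (2 * r + 1) → ℕ) {Q : Polynomial ℚ}
    (hQ : (1 + Polynomial.X) * Q = ∏ i, (1 - (-Polynomial.X) ^ beta i))
    (hdeg : Q.natDegree < ∑ i, beta i) :
    hookSeries (∑ i, beta i) Q =
      C (∏ i, (beta i : ℚ)) * (X ^ (2 * r) * sinhRatio fun i => (beta i : ℚ)) := by
  have h := hookSeries_mul ⟨r, rfl⟩ beta hQ hdeg
  have hS : sinhQuotient * sinhQuotient⁻¹ = 1 :=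
    PowerSeries.mul_inv_cancel _ (by rw [constantCoeff_sinhQuotient]; exact one_ne_zero)
  simp_rw [sinhSeries_eq (beta _ : ℕ)] at h
  rw [sinhSeries_eq 1, prod_mul_distrib, prod_mul_distrib, prod_const, card_univ, Fintype.card_fin,
    ← map_prod, rescale_one, map_one, one_mul, RingHom.id_apply, pow_succ] at h
  have hX : (X : PowerSeries ℚ) ≠ 0 := X_ne_zero
  refine mul_right_cancel₀ hX ?_
  calc hookSeries (∑ i, beta i) Q * X
      = hookSeries (∑ i, beta i) Q * (X * sinhQuotient) * sinhQuotient⁻¹ := by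
        rw [mul_assoc, mul_assoc, hS, mul_one]
    _ = _ := by
        rw [h, sinhRatio]
        ring

theorem sum_coeff_mul_pow {r : ℕ} (beta : Fin (2 * r + 1) → ℕ) {Q : Polynomial ℚ}
    (hQ : (1 + Polynomial.X) * Q = ∏ i, (1 - (-Polynomial.X) ^ beta i))
    (hdeg : Q.natDegree < ∑ i, beta i) (m : ℕ) :
    ∑ k ∈ range (∑ i, beta i), (-1) ^ k * Q.coeff k *
      ((k : ℚ) - (((∑ i, beta i : ℕ) : ℚ) - 1) / 2) ^ (2 * m) =
    (∏ i, (beta i : ℚ)) * ((2 * m).factorial *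
      if r ≤ m then coeff (2 * (m - r)) (sinhRatio fun i => (beta i : ℚ)) else 0) := by
  have h := congrArg (coeff (2 * m)) (hookSeries_eq beta hQ hdeg)
  rw [hookSeries, map_sum, coeff_C_mul, coeff_X_pow_mul'] at h
  have hf : ((2 * m).factorial : ℚ) ≠ 0 := by positivity
  have h1 : (if r ≤ m then coeff (2 * (m - r)) (sinhRatio fun i => (beta i : ℚ)) else 0) =
      if 2 * r ≤ 2 * m then coeff (2 * m - 2 * r) (sinhRatio fun i => (beta i : ℚ)) else 0 := by
    rw [Nat.mul_sub]
    simp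
  rw [h1, mul_left_comm, ← h, mul_sum]
  refine sum_congr rfl fun k _ => ?_
  rw [coeff_C_mul, coeff_expSeries]
  field_simp

/-- The coefficients of `∏ S(X_i u) / S(u)` as polynomials in the variables `X_i`. -/
def sinhRatioPoly (n j : ℕ) : MvPolynomial (Fin n) ℚ :=
  coeff j ((∏ i, rescale (MvPolynomial.X i) (map MvPolynomial.C sinhQuotient)) *
    map MvPolynomial.C sinhQuotient⁻¹)

theorem eval_sinhRatioPoly {n : ℕ} (x : Fin n → ℚ) (j : ℕ) :
    MvPolynomial.eval x (sinhRatioPoly n j) = coeff j (sinhRatio x) := by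
  rw [sinhRatioPoly, ← coeff_map, map_mul, map_prod, sinhRatio]
  congr 2
  · refine prod_congr rfl fun i _ => ?_
    ext m
    simp [coeff_rescale]
  · ext m
    simp

theorem constantCoeff_sinhRatioPoly (n j : ℕ) :
    MvPolynomial.constantCoeff (sinhRatioPoly n j) = coeff j sinhQuotient⁻¹ := by
  rw [← MvPolynomial.eval_zero, eval_sinhRatioPoly, sinhRatio]
  simp [rescale_zero, constantCoeff_sinhQuotient]

end Series

/-! ### The Hurwitz polynomial -/

section Polynomial

/-- The cofactor of `(X₁ + … + X_n) ^ s` in the Hurwitz polynomial, for `n = 2 r + 1` and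
`s = g + r`. -/
def hurwitzCofactor (g r : ℕ) : MvPolynomial (Fin (2 * r + 1)) ℚ :=
  MvPolynomial.C (((g + r).factorial : ℚ) * 2 ^ (g + r))⁻¹ *
    ∑ m ∈ range (g + r + 1),
      (MvPolynomial.C ((2 * m).factorial : ℚ) *
        (if r ≤ m then sinhRatioPoly (2 * r + 1) (2 * (m - r)) else 0)) *
      (MvPolynomial.C (1 / 12) * (∑ i, MvPolynomial.X i) ^ 2) ^ (g + r - m) *
      MvPolynomial.C ((g + r).choose m : ℚ)

/-- Terms with $m<g+r$ contain a positive power of $\sum X_i$, so only $m=g+r$ contributes. -/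
theorem constantCoeff_hurwitzCofactor (g r : ℕ) :
    MvPolynomial.constantCoeff (hurwitzCofactor g r) =
      (((g + r).factorial : ℚ) * 2 ^ (g + r))⁻¹ * (2 * (g + r)).factorial *
        PowerSeries.coeff (2 * g) sinhQuotient⁻¹ := by
  rw [hurwitzCofactor, map_mul, MvPolynomial.constantCoeff_C, map_sum, sum_range_succ,
    sum_eq_zero, zero_add]
  · rw [if_pos (by omega), Nat.add_sub_cancel, Nat.sub_self, Nat.choose_self]
    simp only [map_mul, MvPolynomial.constantCoeff_C, pow_zero, map_one, mul_one, Nat.cast_one,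
      constantCoeff_sinhRatioPoly]
    ring
  · intro m hm
    have h : g + r - m ≠ 0 := by
      have := mem_range.1 hm
      omega
    have h0 : MvPolynomial.constantCoeff 
        (∑ i : Fin (2 * r + 1), MvPolynomial.X i : MvPolynomial _ ℚ) = 0 := by
      simp
    rw [map_mul, map_mul, map_mul, map_pow, map_mul, map_pow, h0, zero_pow two_ne_zero, mul_zero, zero_pow h,
      mul_zero, zero_mul]

/-! ### Existence and uniqueness of the polynomial -/

theorem ofTuple_parts {n : ℕ} {beta : Fin n → ℕ} (h : ∀ i, 0 < beta i) :
    (ofTuple beta).parts = Finset.univ.val.map beta := by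
  refine (Nat.Partition.ofSums_parts _ (Finset.univ.val.map beta) rfl).trans ?_
  rw [Multiset.filter_eq_self]
  intro a ha
  obtain ⟨i, _, rfl⟩ := Multiset.mem_map.1 ha
  exact (h i).ne'

theorem permPoly_permOfType {n : ℕ} {beta : Fin n → ℕ} (h : ∀ i, 0 < beta i) :
    permPoly (permOfType (ofTuple beta)) = ∏ i, (1 - (-Polynomial.X) ^ beta i) := by
  have h1 : (permOfType (ofTuple beta)).partition.parts = (ofTuple beta).parts :=
    (exists_perm_of_type _).choose_spec
  rw [permPoly_eq_partition, h1, ofTuple_parts h, Multiset.map_map]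
  rfl

theorem isHurwitzPolynomial_explicit (g r : ℕ) :
    IsHurwitzPolynomial g (2 * r + 1) ((∑ i, MvPolynomial.X i) ^ (g + r) * hurwitzCofactor g r) := by
  intro beta hbeta
  have hd : 0 < ∑ i, beta i := sum_pos (fun i _ => hbeta i) univ_nonempty
  have hne : Nonempty (Fin (∑ i, beta i)) := ⟨⟨0, hd⟩⟩
  have hnum : numCycles g 2 (Nat.Partition.indiscrete (∑ i, beta i)) (ofTuple beta) = g + r := by
    rw [numCycles, parts_indiscrete hd, ofTuple_parts hbeta]
    simp
    omega
  set mu := ofTuple beta with hmu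
  set Q := hookPoly (permOfType mu) with hQdef
  have hQ : (1 + Polynomial.X) * Q = ∏ i, (1 - (-Polynomial.X) ^ beta i) := by
    rw [hQdef, one_add_X_mul_hookPoly, permPoly_permOfType hbeta]
  have hdeg : Q.natDegree < ∑ i, beta i := by
    simpa using natDegree_hookPoly_lt (permOfType mu)
  have hprod : (mu.parts.prod : ℚ) = ∏ i, (beta i : ℚ) := by
    rw [hmu, ofTuple_parts hbeta]
    exact Nat.cast_prod _ _
  have hprod0 : ∏ i, (beta i : ℚ) ≠ 0 :=
    prod_ne_zero_iff.2 fun i _ => by exact_mod_cast (hbeta i).ne'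
  have hsum := sum_chi_eq hd (g + r) mu
  have hmom := sum_coeff_mul_pow beta hQ hdeg
  rw [doubleHurwitz, hnum, hprod, parts_indiscrete hd, Multiset.prod_singleton, hsum]
  set d := ∑ i, beta i with hddef
  have hd0 : (d : ℚ) ≠ 0 := by exact_mod_cast hd.ne'
  have hX : MvPolynomial.eval (fun i => (beta i : ℚ)) (∑ i, MvPolynomial.X i) = d := by
    simp [hddef]
  set A : ℕ → ℚ := fun m => if r ≤ m then
    PowerSeries.coeff (2 * (m - r)) (sinhRatio fun i => (beta i : ℚ)) else 0 with hA
  -- Binomial expansion of $(c^2+d^2/12)^{g+r}$, after which the sum over $k$ becomes the moments in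
  -- `hmom`. The product of the `beta i` that comes out cancels the normalisation of the Hurwitz
  -- number.
  have hexp : ∑ k ∈ range d, (-1) ^ k *
      ((d : ℚ) / 2 * ((k - ((d : ℚ) - 1) / 2) ^ 2 + (d : ℚ) ^ 2 / 12)) ^ (g + r) * Q.coeff k =
      (∏ i, (beta i : ℚ)) * (((d : ℚ) / 2) ^ (g + r) * ∑ m ∈ range (g + r + 1),
        ((2 * m).factorial * A m) * ((d : ℚ) ^ 2 / 12) ^ (g + r - m) * (g + r).choose m) := by
    calc _ = ∑ k ∈ range d, ∑ m ∈ range (g + r + 1), ((d : ℚ) / 2) ^ (g + r) *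
          (((-1) ^ k * Q.coeff k * ((k : ℚ) - ((d : ℚ) - 1) / 2) ^ (2 * m)) *
            ((d : ℚ) ^ 2 / 12) ^ (g + r - m) * (g + r).choose m) := by
          refine sum_congr rfl fun k _ => ?_
          rw [mul_pow, add_pow, mul_sum, mul_sum, sum_mul]
          refine sum_congr rfl fun m _ => ?_
          rw [pow_mul]
          ring
      _ = _ := by
          rw [sum_comm, mul_sum, mul_sum]
          refine sum_congr rfl fun m _ => ?_
          rw [← mul_sum, ← sum_mul, ← sum_mul, hmom m]
          ring
  rw [hexp, map_mul, map_pow, hX, hurwitzCofactor, map_mul, map_sum]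
  have hterm : ∀ m ∈ range (g + r + 1), MvPolynomial.eval (fun i => (beta i : ℚ))
      ((MvPolynomial.C ((2 * m).factorial : ℚ) *
        (if r ≤ m then sinhRatioPoly (2 * r + 1) (2 * (m - r)) else 0)) *
      (MvPolynomial.C (1 / 12) * (∑ i, MvPolynomial.X i) ^ 2) ^ (g + r - m) *
      MvPolynomial.C ((g + r).choose m : ℚ)) =
      ((2 * m).factorial * A m) * ((d : ℚ) ^ 2 / 12) ^ (g + r - m) * (g + r).choose m := by
    intro m _
    rw [map_mul, map_mul, map_mul, map_pow, map_mul, map_pow, hX, MvPolynomial.eval_C,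
      MvPolynomial.eval_C, MvPolynomial.eval_C, apply_ite (MvPolynomial.eval _), map_zero,
      eval_sinhRatioPoly, hA, one_div_mul_eq_div]
  rw [sum_congr rfl hterm, MvPolynomial.eval_C, div_pow]
  have hf : ((g + r).factorial : ℚ) ≠ 0 := by positivity
  rw [← hddef]
  field_simp

theorem isHurwitzPolynomial_unique {g n : ℕ} {P P' : MvPolynomial (Fin n) ℚ}
    (h : IsHurwitzPolynomial g n P) (h' : IsHurwitzPolynomial g n P') : P = P' := by
  refine MvPolynomial.funext_set (fun _ => Set.range fun k : ℕ => ((k + 1 : ℕ) : ℚ))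
    (fun _ => Set.infinite_range_of_injective fun a b hab => by simpa using hab) fun x hx => ?_
  choose k hk using fun i => hx i (Set.mem_univ i)
  have hx' : x = fun i => ((k i + 1 : ℕ) : ℚ) := funext fun i => (hk i).symm
  rw [hx', h (fun i => k i + 1) (fun _ => Nat.succ_pos _),
    h' (fun i => k i + 1) (fun _ => Nat.succ_pos _)]

theorem hurwitzPolynomial_eq (g r : ℕ) :
    hurwitzPolynomial g (2 * r + 1) = (∑ i, MvPolynomial.X i) ^ (g + r) * hurwitzCofactor g r := by
  have h : ∃ P, IsHurwitzPolynomial g (2 * r + 1) P := ⟨_, isHurwitzPolynomial_explicit g r⟩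
  rw [hurwitzPolynomial, dif_pos h]
  exact isHurwitzPolynomial_unique h.choose_spec (isHurwitzPolynomial_explicit g r)

/-- The power of the sum is homogeneous of degree $s$, so in total degree $s$ it can only meet the
constant term of `P`; what remains is a multinomial coefficient. -/
theorem coeff_sum_X_pow_mul {n : ℕ} (s : ℕ) (P : MvPolynomial (Fin n) ℚ) (b : Fin n →₀ ℕ)
    (hb : ∑ i, b i = s) :
    ((∑ i, MvPolynomial.X i) ^ s * P).coeff b =
      (s.factorial : ℚ) / (∏ i, ((b i).factorial : ℚ)) * MvPolynomial.constantCoeff P := by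
  have hsum : ∀ c : Fin n →₀ ℕ, (c.sum fun _ m => m) = ∑ i, c i := fun c =>
    Finsupp.sum_fintype _ _ fun _ => rfl
  rw [MvPolynomial.coeff_mul, sum_eq_single (b, 0)]
  · rw [MvPolynomial.coeff_sum_X_pow_of_fintype, hsum, if_pos hb, MvPolynomial.constantCoeff_eq]
    congr 1
    rw [eq_div_iff (prod_ne_zero_iff.2 fun i _ => by positivity), mul_comm, ← hb,
      Finsupp.multinomial_eq_of_support_subset (subset_univ b.support),
      ← Nat.multinomial_spec univ b]
    push_cast
    ring
  · rintro ⟨c, e⟩ hce hne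
    rw [HasAntidiagonal.mem_antidiagonal] at hce
    rw [MvPolynomial.coeff_sum_X_pow_of_fintype, hsum, if_neg, Nat.cast_zero, zero_mul]
    intro (hc : ∑ i, c i = s)
    apply hne
    have h1 : ∑ i, b i = ∑ i, c i + ∑ i, e i := by
      rw [← sum_add_distrib, ← hce]
      rfl
    have h2 : ∑ i, e i = 0 := by omega
    have h3 : e = 0 := by
      ext i
      exact sum_eq_zero_iff.1 h2 i (mem_univ i)
    simp only at hce
    rw [h3, add_zero] at hce
    rw [h3, hce]
  · intro h
    simp at h

/-- The lowest-degree combinatorial Hodge integrals in closed form. -/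
theorem hodgeIntegral_eq (g r : ℕ) (b : Fin (2 * r + 1) → ℤ) (hb : ∀ i, 0 ≤ b i)
    (hsum : ∑ i, (b i : ℚ) = g + r) :
    hodgeIntegral g g b = (-1) ^ g * PowerSeries.coeff (2 * g) sinhQuotient⁻¹ *
      ((2 * (g + r)).factorial / 2 ^ (g + r)) / ∏ i, ((b i).toNat.factorial : ℚ) := by
  rw [hodgeIntegral, if_pos ⟨hb, by rw [hsum]; push_cast; ring⟩, hurwitzPolynomial_eq,
    coeff_sum_X_pow_mul, constantCoeff_hurwitzCofactor]
  · have hf : ((g + r).factorial : ℚ) ≠ 0 := by positivity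
    simp only [Finsupp.equivFunOnFinite_symm_apply_apply]
    field_simp
  · simp only [Finsupp.equivFunOnFinite_symm_apply_apply]
    have : ∑ i, (((b i).toNat : ℕ) : ℚ) = g + r := by
      rw [← hsum]
      refine sum_congr rfl fun i _ => ?_
      have := Int.toNat_of_nonneg (hb i)
      exact_mod_cast congrArg (Int.cast : ℤ → ℚ) this
    exact_mod_cast this

/-! ### Lowering one index and adjoining two indices in the closed form -/

theorem hodgeIntegral_natCast (g r : ℕ) (b : Fin (2 * r + 1) → ℕ)
    (hsum : ∑ i, (b i : ℚ) = g + r) :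
    hodgeIntegral g g (fun i => (b i : ℤ)) = (-1) ^ g * PowerSeries.coeff (2 * g) sinhQuotient⁻¹ *
      ((2 * (g + r)).factorial / 2 ^ (g + r)) / ∏ i, ((b i).factorial : ℚ) := by
  rw [hodgeIntegral_eq g r _ (fun i => Int.natCast_nonneg _) (by simpa using hsum)]
  simp

/-- This is $1/(b_i-1)!=b_i/b_i!$. If $b_i=0$, the left side vanishes by convention and the right
side by its factor $b_i$. -/
theorem hodgeIntegral_update (g r : ℕ) (b : Fin (2 * r + 1) → ℕ)
    (hsum : ∑ i, (b i : ℚ) = g + r + 1) (i : Fin (2 * r + 1)) :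
    hodgeIntegral g g (Function.update (fun j => (b j : ℤ)) i ((b i : ℤ) - 1)) =
      (b i : ℚ) * ((-1) ^ g * PowerSeries.coeff (2 * g) sinhQuotient⁻¹ *
        ((2 * (g + r)).factorial / 2 ^ (g + r)) / ∏ i, ((b i).factorial : ℚ)) := by
  rcases Nat.eq_zero_or_pos (b i) with h0 | hpos
  · rw [h0, hodgeIntegral, if_neg]
    · simp
    · intro h
      have := h.1 i
      simp at this
  · obtain ⟨m, hm⟩ : ∃ m, b i = m + 1 := ⟨b i - 1, by omega⟩
    have hupd : Function.update (fun j => (b j : ℤ)) i ((b i : ℤ) - 1) =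
        fun j => ((Function.update b i m j : ℕ) : ℤ) := by
      ext j
      by_cases hj : j = i
      · subst hj
        simp [hm]
      · simp [hj]
    have hs : ∑ j, ((Function.update b i m j : ℕ) : ℚ) = g + r := by
      rw [← add_sum_erase _ _ (mem_univ i)] at hsum ⊢
      rw [hm] at hsum
      have : ∑ j ∈ univ.erase i, ((Function.update b i m j : ℕ) : ℚ) =
          ∑ j ∈ univ.erase i, (b j : ℚ) :=
        sum_congr rfl fun j hj => by rw [Function.update_of_ne (ne_of_mem_erase hj)]
      rw [this, Function.update_self]
      push_cast at hsum
      linarith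
    have hp : ∏ j, ((b j).factorial : ℚ) =
        (b i : ℚ) * ∏ j, ((Function.update b i m j).factorial : ℚ) := by
      rw [← mul_prod_erase _ _ (mem_univ i), ← mul_prod_erase univ
        (fun j => ((Function.update b i m j).factorial : ℚ)) (mem_univ i)]
      have : ∏ j ∈ univ.erase i, ((Function.update b i m j).factorial : ℚ) =
          ∏ j ∈ univ.erase i, ((b j).factorial : ℚ) :=
        prod_congr rfl fun j hj => by rw [Function.update_of_ne (ne_of_mem_erase hj)]
      rw [this, Function.update_self, hm, Nat.factorial_succ]
      push_cast
      ring
    have hb0 : (b i : ℚ) ≠ 0 := by exact_mod_cast hpos.ne'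
    have hp0 : ∏ j, ((Function.update b i m j).factorial : ℚ) ≠ 0 :=
      prod_ne_zero_iff.2 fun j _ => by positivity
    rw [hupd, hodgeIntegral_natCast g r _ hs, hp]
    field_simp

/-- Common source of both equations: indices $0$ and $1$ leave the product of factorials unchanged,
while $s=g+r$ grows by one, giving the factor $(2s+2)(2s+1)/2$. -/
theorem hodgeIntegral_cons_cons (g r : ℕ) (a c : ℕ) (ha : a ≤ 1) (hc : c ≤ 1)
    (b : Fin (2 * r + 1) → ℕ) (hsum : (a : ℚ) + c + ∑ i, (b i : ℚ) = g + r + 1) :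
    hodgeIntegral g g (Matrix.vecCons (a : ℤ) (Matrix.vecCons (c : ℤ) fun j => (b j : ℤ))) =
      (2 * g + (2 * r + 1 : ℕ)) * (g + r + 1) *
        ((-1) ^ g * PowerSeries.coeff (2 * g) sinhQuotient⁻¹ *
          ((2 * (g + r)).factorial / 2 ^ (g + r)) / ∏ i, ((b i).factorial : ℚ)) := by
  have hfac : ∀ m : ℕ, m ≤ 1 → (m.factorial : ℚ) = 1 := by
    intro m hm
    interval_cases m <;> simp
  have hvec : (Matrix.vecCons (a : ℤ) (Matrix.vecCons (c : ℤ) fun j => (b j : ℤ)) :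
      Fin (2 * (r + 1) + 1) → ℤ) =
      fun j => ((Matrix.vecCons a (Matrix.vecCons c b) : Fin (2 * (r + 1) + 1) → ℕ) j : ℤ) := by
    funext j
    refine Fin.cases ?_ (fun j => Fin.cases ?_ (fun j => ?_) j) j <;> rfl
  have hs : ∑ j, (((Matrix.vecCons a (Matrix.vecCons c b) : Fin (2 * (r + 1) + 1) → ℕ) j : ℕ) : ℚ) =
      g + (r + 1 : ℕ) := by
    -- The index type is rewritten to a definitionally equal one that exhibits the two successors to
    -- be peeled off.
    have : ∑ j : Fin (2 * r + 1 + 1 + 1),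
        (((Matrix.vecCons a (Matrix.vecCons c b) : Fin (2 * r + 1 + 1 + 1) → ℕ) j : ℕ) : ℚ) =
        a + (c + ∑ i, (b i : ℚ)) := by
      rw [Fin.sum_univ_succ, Fin.sum_univ_succ]
      simp
    refine this.trans ?_
    push_cast
    linarith
  have hp : ∏ j, (((Matrix.vecCons a (Matrix.vecCons c b) :
      Fin (2 * (r + 1) + 1) → ℕ) j).factorial : ℚ) = ∏ i, ((b i).factorial : ℚ) := by
    have : ∏ j : Fin (2 * r + 1 + 1 + 1),
        (((Matrix.vecCons a (Matrix.vecCons c b) : Fin (2 * r + 1 + 1 + 1) → ℕ) j).factorial : ℚ) =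
        a.factorial * (c.factorial * ∏ i, ((b i).factorial : ℚ)) := by
      rw [Fin.prod_univ_succ, Fin.prod_univ_succ]
      simp
    refine this.trans ?_
    rw [hfac a ha, hfac c hc, one_mul, one_mul]
  have h := hodgeIntegral_natCast g (r + 1) _ hs
  rw [← hvec, hp] at h
  refine h.trans ?_
  have hp0 : ∏ j, ((b j).factorial : ℚ) ≠ 0 := prod_ne_zero_iff.2 fun j _ => by positivity
  have e : 2 * (g + (r + 1)) = 2 * (g + r) + 1 + 1 := by ring
  rw [e, Nat.factorial_succ, Nat.factorial_succ, ← add_assoc g r 1, pow_succ]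
  push_cast
  field_simp
  ring

end Polynomial

end CompletedHurwitz

end

open CompletedHurwitz

theorem proposition4p3 (g n : ℕ) (hn : Odd n) :
    -- the combinatorial Hodge integrals are well defined
    (∃! P : MvPolynomial (Fin n) ℚ, IsHurwitzPolynomial g n P) ∧
    -- string equation
    (∀ b : Fin n → ℕ, (∑ i, (b i : ℚ)) = g + ((n : ℚ) + 1) / 2 →
      hodgeIntegral g g (Matrix.vecCons 0 (Matrix.vecCons 0 fun j => (b j : ℤ))) =
        (2 * g + n) * ∑ i, hodgeIntegral g g
          (Function.update (fun j => (b j : ℤ)) i ((b i : ℤ) - 1))) ∧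
    -- dilaton equation
    (∀ b : Fin n → ℕ, (∑ i, (b i : ℚ)) = g + ((n : ℚ) - 1) / 2 →
      hodgeIntegral g g (Matrix.vecCons 0 (Matrix.vecCons 1 fun j => (b j : ℤ))) =
        (2 * g + n) * (g + ((n : ℚ) + 1) / 2) * hodgeIntegral g g fun j => (b j : ℤ)) := by
  obtain ⟨r, rfl⟩ := hn
  refine ⟨⟨_, isHurwitzPolynomial_explicit g r, fun P hP =>
    isHurwitzPolynomial_unique hP (isHurwitzPolynomial_explicit g r)⟩, fun b hb => ?_,
    fun b hb => ?_⟩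
  · have hs : ∑ i, (b i : ℚ) = g + r + 1 := by
      rw [hb]
      push_cast
      ring
    have h := hodgeIntegral_cons_cons g r 0 0 zero_le_one zero_le_one b (by simpa using hs)
    rw [Nat.cast_zero] at h
    -- The lowered integrals carry factors $b_i$, whose sum is $g+r+1$, the remaining factor on the
    -- left.
    rw [h, Finset.sum_congr rfl fun i _ => hodgeIntegral_update g r b hs i, ← Finset.sum_mul, hs]
    ring
  · have hs : ∑ i, (b i : ℚ) = g + r := by
      rw [hb]
      push_cast
      ring
    have h := hodgeIntegral_cons_cons g r 0 1 zero_le_one le_rfl b (by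
      rw [hs]
      push_cast
      ring)
    rw [Nat.cast_zero, Nat.cast_one] at h
    rw [h, hodgeIntegral_natCast g r b hs]
    push_cast
    ring
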